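/- Let $G$ be a finite group and let $\mathcal{O}_G$ be its orbit category (objects $G/H$ for $H\le G$, morphisms the $G$-maps). All algebras are over $\mathbb{Q}$, unital, $\mathbb{N}$-graded and graded-commutative; DGAs have a differential of degree $+1$. Definitions. A diagram of DGAs (of graded algebras) is a covariant functor from $\mathcal{O}_G$ to DGAs (graded algebras). A system of DGAs is a diagram of DGAs which in every degree is an injective object of the category of covariant functors from $\mathcal{O}_G$ to rational vector spaces. A morphism of diagrams of DGAs is a quasi-isomorphism if it induces an isomorphism on cohomology at every $G/H$; it is a $k$-isomorphism if at every $G/H$ it induces an isomorphism on $H^i$ for $i\le k$ and a monomorphism on $H^{k+1}$. Let $\mathcal{U}$ be a system of DGAs, $\underline{V}$ a covariant functor from $\mathcal{O}_G$ to rational vector spaces, and $\alpha:\underline{V}\to \underline{Z}^{m+1}(\mathcal{U})$ a morphism to the cocycles. Let $\underline{V}\to\underline{V}_0\xrightarrow{w_0}\underline{V}_1\xrightarrow{w_1}\cdots$ be the minimal injective resolution, and let $\alpha_i:\underline{V}_i\to\mathcal{U}^{m+i+1}$ be morphisms with $\alpha_0|_{\underline{V}}=\alpha$ and $d\alpha_i=\alpha_{i+1}w_i$.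 The corresponding elementary extension of degree $m$ is $\mathcal{U}^{\alpha}(\underline{V})=\mathcal{U}\otimes\bigotimes_i\mathbb{Q}(\underline{V}_i)$, where $\mathbb{Q}(\underline{V}_i)$ is the free graded commutative algebra on $\underline{V}_i$ in degree $m+i$, with the differential of $\mathcal{U}$ on $\mathcal{U}$ and $d=(-1)^i\alpha_i+w_i$ on $\underline{V}_i$. A minimal system is a system of DGAs $\mathscr{M}$ together with an exhausting increasing sequence of subsystems $\mathscr{M}_0=\mathscr{M}_1=\mathbb{Q}\subseteq\mathscr{M}_2\subseteq\cdots$, $\mathscr{M}=\bigcup_m\mathscr{M}_m$, such that for each $m\ge 2$, $\mathscr{M}_m$ is an elementary extension of $\mathscr{M}_{m-1}$ of degree $m$. A minimal model of a diagram of graded algebras $\mathcal{A}$ is a minimal system $\mathscr{M}$ with a quasi-isomorphism $\mathscr{M}\to\mathcal{I}$, where $\mathcal{I}$ is a system of DGAs that receives an injective quasi-isomorphism from $(\mathcal{A},0)$ (if $\mathcal{A}$ is itself injective one can take $\mathcal{I}=(\mathcal{A},0)$). The diagram $\mathcal{A}$ is called $k$-intrinsically formal ($k$-I.F.) if for any two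 minimal systems $\mathscr{M},\mathscr{M}'$ with $H^*(\mathscr{M})\cong\mathcal{A}\cong H^*(\mathscr{M}')$ as diagrams of graded algebras there is a $k$-isomorphism $\mathscr{M}_k\to\mathscr{M}'_k$ or a $k$-isomorphism $\mathscr{M}'_k\to\mathscr{M}_k$. Proposition. Let $n\ge 0$ and let $\mathcal{A}$ be a diagram of graded algebras over $\mathcal{O}_G$ which is $n$-I.F. and satisfies $\mathcal{A}^{n+1}=\mathcal{A}^{n+2}=0$. Let $\mathscr{M}$ be a minimal model of $\mathcal{A}$ with $\mathscr{M}_n=\mathscr{M}_{n+1}$. Then $\mathcal{A}$ is $(n+1)$-I.F. -/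

import Mathlib

open CategoryTheory CategoryTheory.Limits

universe v u

noncomputable section

namespace EquivFormal

/-! ## The orbit category -/

/-- The objects of the orbit category of `G`: the subgroup `H` stands for the `G`-set `G ⧸ H`. -/
structure OrbitCat (G : Type v) [Group G] where
  /-- the subgroup `H` of the orbit `G ⧸ H` -/
  sub : Subgroup G

/-- Morphisms `G ⧸ H ⟶ G ⧸ K` are the `G`-equivariant maps. -/
instance (G : Type v) [Group G] : Category.{v} (OrbitCat G) where
  Hom H K := (G ⧸ H.sub) →[G] (G ⧸ K.sub)
  id H := MulActionHom.id G
  comp f g := g.comp f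

/-! ## Graded commutative algebras -/

/-- A graded-commutative `ℚ`-algebra, graded by the natural numbers. -/
structure GCAlg where
  /-- the total space of the algebra -/
  carrier : Type u
  [ring : Ring carrier]
  [algebra : Algebra ℚ carrier]
  /-- the homogeneous parts -/
  gr : ℕ → Submodule ℚ carrier
  [gradedMonoid : SetLike.GradedMonoid gr]
  isInternal : DirectSum.IsInternal gr
  comm : ∀ (i j : ℕ) (a b : carrier), a ∈ gr i → b ∈ gr j →
    a * b = (-1 : ℚ) ^ (i * j) • (b * a)

attribute [instance] GCAlg.ring GCAlg.algebra GCAlg.gradedMonoid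

/-- Morphisms of graded algebras: unital algebra maps preserving degrees. -/
@[ext]
structure GCAlg.Hom (A B : GCAlg.{u}) where
  /-- the underlying algebra map -/
  toAlgHom : A.carrier →ₐ[ℚ] B.carrier
  map_gr : ∀ (i : ℕ) (a : A.carrier), a ∈ A.gr i → toAlgHom a ∈ B.gr i

instance : Category.{u} GCAlg.{u} where
  Hom A B := GCAlg.Hom A B
  id A := ⟨AlgHom.id ℚ A.carrier, fun _ _ h => h⟩
  comp f g := ⟨g.toAlgHom.comp f.toAlgHom, fun i a h => g.map_gr i _ (f.map_gr i a h)⟩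

/-- The algebra map underlying a morphism of graded algebras. -/
def GCAlg.fn {A B : GCAlg.{u}} (f : A ⟶ B) : A.carrier →ₐ[ℚ] B.carrier :=
  GCAlg.Hom.toAlgHom f

/-! ## Commutative differential graded algebras -/

/-- A commutative differential graded algebra over `ℚ`, with a differential of degree `+1`. -/
structure CDGA extends GCAlg.{u} where
  /-- the differential -/
  d : carrier →ₗ[ℚ] carrier
  d_mem : ∀ (i : ℕ) (a : carrier), a ∈ gr i → d a ∈ gr (i + 1)
  d_d : ∀ a : carrier, d (d a) = 0
  leibniz : ∀ (i : ℕ) (a b : carrier), a ∈ gr i →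
    d (a * b) = d a * b + (-1 : ℚ) ^ i • (a * d b)

/-- Morphisms of DGAs: morphisms of graded algebras commuting with the differentials. -/
@[ext]
structure CDGA.Hom (A B : CDGA.{u}) extends GCAlg.Hom A.toGCAlg B.toGCAlg where
  map_d : ∀ a : A.carrier, toAlgHom (A.d a) = B.d (toAlgHom a)

instance : Category.{u} CDGA.{u} where
  Hom A B := CDGA.Hom A B
  id A := ⟨⟨AlgHom.id ℚ A.carrier, fun _ _ h => h⟩, fun _ => rfl⟩
  comp f g := ⟨⟨g.toAlgHom.comp f.toAlgHom, fun i a h => g.map_gr i _ (f.map_gr i a h)⟩,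
    fun a => (congrArg g.toAlgHom (f.map_d a)).trans (g.map_d _)⟩

/-- The algebra map underlying a morphism of DGAs. -/
def CDGA.fn {A B : CDGA.{u}} (f : A ⟶ B) : A.carrier →ₐ[ℚ] B.carrier :=
  (CDGA.Hom.toHom f).toAlgHom

/-- Forgetting the differential. -/
def CDGA.forgetD : CDGA.{u} ⥤ GCAlg.{u} where
  obj A := A.toGCAlg
  map f := CDGA.Hom.toHom f

/-- A graded algebra, regarded as a DGA with zero differential. -/
def GCAlg.zeroD : GCAlg.{u} ⥤ CDGA.{u} where
  obj A :=
    { A with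
      d := 0
      d_mem := fun i _ _ => (A.gr (i + 1)).zero_mem
      d_d := fun _ => rfl
      leibniz := fun i a b _ => by simp }
  map {A B} f :=
    { toHom := f
      map_d := fun a => map_zero (GCAlg.fn f) }

/-- The degree `i` part of a DGA, as a functor to rational vector spaces. -/
def CDGA.deg (i : ℕ) : CDGA.{u} ⥤ ModuleCat.{u} ℚ where
  obj A := ModuleCat.of ℚ (A.gr i)
  map {A B} f := ModuleCat.ofHom
    ((CDGA.fn f).toLinearMap.restrict (p := A.gr i) (q := B.gr i)
      (fun a h => (CDGA.Hom.toHom f).map_gr i a h))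

/-! ## The cohomology algebra -/

namespace GCAlg

variable (A : GCAlg.{u})

/-- The decomposition of a graded algebra into its homogeneous parts. -/
def decomp : A.carrier ≃ₗ[ℚ] DirectSum ℕ (fun i => A.gr i) :=
  (LinearEquiv.ofBijective (DirectSum.coeLinearMap A.gr)
    (show Function.Bijective (DirectSum.coeLinearMap A.gr) from A.isInternal)).symm

theorem decomp_of_mem {i : ℕ} {a : A.carrier} (h : a ∈ A.gr i) :
    A.decomp a = DirectSum.lof ℚ ℕ (fun i => A.gr i) i ⟨a, h⟩ := by
  rw [decomp, LinearEquiv.symm_apply_eq, LinearEquiv.ofBijective_apply,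
    DirectSum.coeLinearMap_lof]

/-- The projection of a graded algebra to its degree `i` part. -/
def proj (i : ℕ) : A.carrier →ₗ[ℚ] A.carrier :=
  (A.gr i).subtype ∘ₗ DirectSum.component ℚ ℕ (fun i => A.gr i) i ∘ₗ A.decomp.toLinearMap

theorem proj_mem (i : ℕ) (a : A.carrier) : A.proj i a ∈ A.gr i :=
  Submodule.coe_mem _

theorem proj_of_mem {i : ℕ} {a : A.carrier} (h : a ∈ A.gr i) (j : ℕ) :
    A.proj j a = if i = j then a else 0 := by
  simp only [proj, LinearMap.comp_apply, LinearEquiv.coe_coe, A.decomp_of_mem h]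
  split_ifs with hij
  · subst hij
    rw [DirectSum.component.lof_self]
    rfl
  · rw [DirectSum.component.of, dif_neg hij, map_zero]

theorem mem_span_proj (a : A.carrier) (p : ℕ → Submodule ℚ A.carrier)
    (h : ∀ i, A.proj i a ∈ p i) : a ∈ ⨆ i, p i := by
  classical
  have ha : a = DirectSum.coeLinearMap A.gr (A.decomp a) :=
    (A.decomp.symm_apply_apply a).symm
  rw [ha, DirectSum.coeLinearMap_eq_dfinsuppSum, DFinsupp.sum]
  exact Submodule.sum_mem _ fun i _ => Submodule.mem_iSup_of_mem i (h i)

theorem induction {p : A.carrier → Prop} (a : A.carrier) (h0 : p 0)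
    (hadd : ∀ a b, p a → p b → p (a + b)) (hh : ∀ i, ∀ a ∈ A.gr i, p a) : p a :=
  Submodule.iSup_induction A.gr (motive := p)
    (A.mem_span_proj a A.gr fun i => A.proj_mem i a) hh h0 hadd

end GCAlg

namespace CDGA

variable (A : CDGA.{u})

theorem d_one : A.d 1 = 0 := by
  have h := A.leibniz 0 1 1 (SetLike.GradedOne.one_mem (A := A.gr))
  simpa using h

theorem proj_succ_d (i : ℕ) (a : A.carrier) :
    A.proj (i + 1) (A.d a) = A.d (A.proj i a) := by
  refine A.toGCAlg.induction
    (p := fun a => A.proj (i + 1) (A.d a) = A.d (A.proj i a)) a (by simp only [map_zero])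
    (fun a b ha hb => by simp only [map_add, ha, hb]) ?_
  intro j a ha
  rw [A.proj_of_mem ha, A.proj_of_mem (A.d_mem j a ha)]
  split_ifs with h1 h2 h2 <;> first | rfl | omega | simp

theorem proj_zero_d (a : A.carrier) : A.proj 0 (A.d a) = 0 := by
  refine A.toGCAlg.induction (p := fun a => A.proj 0 (A.d a) = 0) a (by simp only [map_zero])
    (fun a b ha hb => by simp only [map_add, ha, hb, add_zero]) ?_
  intro j a ha
  rw [A.proj_of_mem (A.d_mem j a ha)]
  simp

theorem cocycle_mul_boundary {z : A.carrier} (hz : A.d z = 0) (b : A.carrier) :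
    ∃ c, A.d c = z * A.d b := by
  have hsum : z ∈ ⨆ i, (A.gr i ⊓ LinearMap.ker A.d) :=
    A.mem_span_proj z _ fun i =>
      ⟨A.proj_mem i z, show A.d (A.proj i z) = 0 by rw [← proj_succ_d, hz, map_zero]⟩
  refine Submodule.iSup_induction _ (motive := fun z => ∃ c, A.d c = z * A.d b) hsum
    ?_ ⟨0, by simp⟩ ?_
  · rintro i z ⟨hzi, hz⟩
    have hz' : A.d z = 0 := hz
    refine ⟨(-1 : ℚ) ^ i • (z * b), ?_⟩
    rw [map_smul, A.leibniz i z b hzi, hz', zero_mul, zero_add, smul_smul, ← mul_pow]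
    simp
  · rintro x y ⟨c, hc⟩ ⟨e, he⟩
    exact ⟨c + e, by rw [map_add, hc, he, add_mul]⟩

theorem d_mul_cocycle {z : A.carrier} (hz : A.d z = 0) (b : A.carrier) :
    A.d (b * z) = A.d b * z := by
  refine A.toGCAlg.induction (p := fun b => A.d (b * z) = A.d b * z) b (by simp)
    (fun a b ha hb => by rw [add_mul, map_add, ha, hb, map_add, add_mul]) ?_
  intro i b hb
  rw [A.leibniz i b z hb, hz]
  simp

theorem d_mul_of_cocycles {a b : A.carrier} (ha : A.d a = 0) (hb : A.d b = 0) :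
    A.d (a * b) = 0 := by
  rw [A.d_mul_cocycle hb, ha, zero_mul]

/-- The subalgebra of cocycles. -/
def cocycles : Subalgebra ℚ A.carrier where
  carrier := {a | A.d a = 0}
  mul_mem' := fun ha hb => A.d_mul_of_cocycles ha hb
  add_mem' := fun {a b} (ha : A.d a = 0) (hb : A.d b = 0) =>
    show A.d (a + b) = 0 by rw [map_add, ha, hb, add_zero]
  algebraMap_mem' := fun r => show A.d (algebraMap ℚ A.carrier r) = 0 by
    rw [Algebra.algebraMap_eq_smul_one, map_smul, d_one, smul_zero]

/-- The ideal of coboundaries in the algebra of cocycles. -/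
def coboundaries : Ideal A.cocycles where
  carrier := {a | ∃ c, A.d c = a}
  add_mem' := by
    rintro a b ⟨c, hc⟩ ⟨e, he⟩
    exact ⟨c + e, by rw [map_add, hc, he]; rfl⟩
  zero_mem' := ⟨0, by rw [map_zero]; rfl⟩
  smul_mem' := by
    rintro z b ⟨c, hc⟩
    obtain ⟨e, he⟩ := A.cocycle_mul_boundary z.2 c
    exact ⟨e, by rw [he, hc]; rfl⟩

theorem mem_coboundaries {a : A.cocycles} : a ∈ A.coboundaries ↔ ∃ c, A.d c = a := Iff.rfl

instance : A.coboundaries.IsTwoSided where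
  mul_mem_of_left := by
    rintro a b ⟨c, hc⟩
    exact ⟨c * b, by rw [A.d_mul_cocycle b.2, hc]; rfl⟩

/-- The cohomology of a DGA: cocycles modulo coboundaries. -/
abbrev cohomologyCarrier : Type u := A.cocycles ⧸ A.coboundaries

/-- The cohomology class of a cocycle. -/
def cls : A.cocycles →ₐ[ℚ] A.cohomologyCarrier := Ideal.Quotient.mkₐ ℚ A.coboundaries

theorem cls_surjective : Function.Surjective A.cls := Ideal.Quotient.mkₐ_surjective ℚ _

theorem cls_eq_zero {a : A.cocycles} : A.cls a = 0 ↔ ∃ c, A.d c = a :=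
  Ideal.Quotient.eq_zero_iff_mem

/-- The degree `i` cohomology classes are those of degree `i` cocycles. -/
def cohomologyGr (i : ℕ) : Submodule ℚ A.cohomologyCarrier :=
  ((A.gr i).comap A.cocycles.val.toLinearMap).map A.cls.toLinearMap

theorem mem_cohomologyGr {i : ℕ} {x : A.cohomologyCarrier} :
    x ∈ A.cohomologyGr i ↔ ∃ a : A.cocycles, (a : A.carrier) ∈ A.gr i ∧ A.cls a = x := Iff.rfl

instance : SetLike.GradedMonoid A.cohomologyGr where
  one_mem := ⟨1, SetLike.GradedOne.one_mem (A := A.gr), map_one A.cls⟩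
  mul_mem := by
    rintro i j _ _ ⟨a, ha, rfl⟩ ⟨b, hb, rfl⟩
    exact ⟨a * b, SetLike.GradedMul.mul_mem (A := A.gr) ha hb, map_mul A.cls a b⟩

theorem d_proj_cocycle (a : A.cocycles) (i : ℕ) : A.d (A.proj i a) = 0 := by
  have : A.d (a : A.carrier) = 0 := a.2
  rw [← proj_succ_d, this, map_zero]

theorem cohomologyGr_indep : iSupIndep A.cohomologyGr := by
  rw [iSupIndep_iff_finsetSum_eq_zero_imp_eq_zero]
  intro s v hv hs j hj
  have hv' : ∀ i, ∃ a : A.cocycles, i ∈ s → (a : A.carrier) ∈ A.gr i ∧ A.cls a = v i := by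
    intro i
    by_cases hi : i ∈ s
    · obtain ⟨a, ha⟩ := A.mem_cohomologyGr.1 (hv i hi)
      exact ⟨a, fun _ => ha⟩
    · exact ⟨0, fun h => absurd h hi⟩
  choose z hz using hv'
  have hsum : A.cls (∑ i ∈ s, z i) = 0 := by
    rw [map_sum, ← hs]
    exact Finset.sum_congr rfl fun i hi => (hz i hi).2
  obtain ⟨c, hc⟩ := A.cls_eq_zero.1 hsum
  rw [← (hz j hj).2, A.cls_eq_zero]
  have hp : A.proj j (A.d c) = z j := by
    rw [hc, AddSubmonoidClass.coe_finsetSum, map_sum, Finset.sum_eq_single j]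
    · rw [A.proj_of_mem (hz j hj).1, if_pos rfl]
    · intro i hi hij
      rw [A.proj_of_mem (hz i hi).1, if_neg hij]
    · intro h
      exact absurd hj h
  cases j with
  | zero => exact ⟨0, by rw [map_zero, ← hp, proj_zero_d]⟩
  | succ k => exact ⟨A.proj k c, by rw [← hp, proj_succ_d]⟩

theorem cohomologyGr_iSup : ⨆ i, A.cohomologyGr i = ⊤ := by
  rw [eq_top_iff]
  rintro x -
  obtain ⟨a, rfl⟩ := A.cls_surjective x
  have h : (a : A.carrier) ∈ ⨆ i, (A.gr i ⊓ LinearMap.ker A.d) :=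
    A.mem_span_proj a _ fun i => ⟨A.proj_mem i a, A.d_proj_cocycle a i⟩
  have h2 : (⨆ i, (A.gr i ⊓ LinearMap.ker A.d)) ≤
      ((⨆ i, A.cohomologyGr i).comap A.cls.toLinearMap).map A.cocycles.val.toLinearMap := by
    refine iSup_le fun i => ?_
    rintro y ⟨hy, hdy⟩
    exact ⟨⟨y, hdy⟩, Submodule.mem_iSup_of_mem i ⟨⟨y, hdy⟩, hy, rfl⟩, rfl⟩
  obtain ⟨b, hb, hba⟩ := h2 h
  have : b = a := Subtype.ext hba
  exact this ▸ hb

/-- The cohomology algebra of a DGA. -/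
def cohomology : GCAlg.{u} where
  carrier := A.cohomologyCarrier
  gr := A.cohomologyGr
  isInternal := (DirectSum.isInternal_submodule_iff_iSupIndep_and_iSup_eq_top _).2
    ⟨A.cohomologyGr_indep, A.cohomologyGr_iSup⟩
  comm := by
    rintro i j _ _ ⟨a, ha, rfl⟩ ⟨b, hb, rfl⟩
    change A.cls a * A.cls b = (-1 : ℚ) ^ (i * j) • (A.cls b * A.cls a)
    rw [← map_mul, ← map_mul, ← map_smul]
    congr 1
    exact Subtype.ext (A.comm i j a b ha hb)

variable {A} {B : CDGA.{u}}

theorem fn_d (f : A ⟶ B) (a : A.carrier) : fn f (A.d a) = B.d (fn f a) :=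
  CDGA.Hom.map_d f a

/-- The map on cocycles induced by a morphism. -/
def cocyclesMap (f : A ⟶ B) : A.cocycles →ₐ[ℚ] B.cocycles :=
  ((fn f).comp A.cocycles.val).codRestrict B.cocycles fun a => by
    have ha : A.d (a : A.carrier) = 0 := a.2
    change B.d (fn f a) = 0
    rw [← fn_d, ha, map_zero]

/-- The map on cohomology induced by a morphism: the class of `z` goes to the class of `f z`. -/
def cohomologyMap (f : A ⟶ B) : A.cohomology ⟶ B.cohomology where
  toAlgHom := Ideal.Quotient.liftₐ A.coboundaries (B.cls.comp (cocyclesMap f)) (by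
    rintro a ⟨c, hc⟩
    refine B.cls_eq_zero.2 ⟨fn f c, ?_⟩
    rw [← fn_d, hc]
    rfl)
  map_gr := by
    rintro i _ ⟨a, ha, rfl⟩
    exact ⟨cocyclesMap f a, (CDGA.Hom.toHom f).map_gr i _ ha, rfl⟩

/-- Cohomology, as a functor from DGAs to graded commutative algebras. -/
def H : CDGA.{u} ⥤ GCAlg.{u} where
  obj A := A.cohomology
  map f := cohomologyMap f
  map_id A := by
    apply GCAlg.Hom.ext
    apply AlgHom.ext
    intro x
    obtain ⟨a, rfl⟩ := A.cls_surjective x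
    rfl
  map_comp {A B C} f g := by
    apply GCAlg.Hom.ext
    apply AlgHom.ext
    intro x
    obtain ⟨a, rfl⟩ := A.cls_surjective x
    rfl

end CDGA

/-! ## Diagrams and systems -/

/-- Diagrams of DGAs: covariant functors from the orbit category to DGAs. -/
abbrev DGADiagram (G : Type v) [Group G] := OrbitCat G ⥤ CDGA.{u}

/-- Diagrams of graded commutative algebras over the orbit category. -/
abbrev GADiagram (G : Type v) [Group G] := OrbitCat G ⥤ GCAlg.{u}

/-- Dual rational coefficient systems: covariant functors to rational vector spaces. -/
abbrev DualCoeff (G : Type v) [Group G] := OrbitCat G ⥤ ModuleCat.{u} ℚ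

section Diagrams

variable {G : Type v} [Group G]

/-- A system of DGAs: a diagram whose underlying graded dual coefficient system is injective. -/
def IsSystem (U : DGADiagram.{v, u} G) : Prop :=
  ∀ i : ℕ, Injective (U ⋙ CDGA.deg i)

/-- The diagram of cohomology algebras. -/
def cohomologyDiagram (U : DGADiagram.{v, u} G) : GADiagram.{v, u} G := U ⋙ CDGA.H

/-- A `k`-isomorphism: at every orbit it is an isomorphism on cohomology in degrees `≤ k` and
a monomorphism in degree `k + 1`. -/
def IsKIso (k : ℕ) {U U' : DGADiagram.{v, u} G} (f : U ⟶ U') : Prop :=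
  ∀ H : OrbitCat G,
    (∀ i ≤ k, Set.BijOn (GCAlg.fn (CDGA.H.map (f.app H)))
      ((CDGA.H.obj (U.obj H)).gr i) ((CDGA.H.obj (U'.obj H)).gr i)) ∧
    Set.InjOn (GCAlg.fn (CDGA.H.map (f.app H))) ((CDGA.H.obj (U.obj H)).gr (k + 1))

/-- A quasi-isomorphism: at every orbit it is an isomorphism on cohomology. -/
def IsQuasiIso {U U' : DGADiagram.{v, u} G} (f : U ⟶ U') : Prop :=
  ∀ H : OrbitCat G, Function.Bijective (GCAlg.fn (CDGA.H.map (f.app H)))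

/-- A morphism of diagrams is an inclusion if it is injective at every orbit. -/
def IsInclusion {U U' : DGADiagram.{v, u} G} (f : U ⟶ U') : Prop :=
  ∀ H : OrbitCat G, Function.Injective (CDGA.fn (f.app H))

/-! ## Minimal injective resolutions -/

/-- `f : X ⟶ Y` is an injective envelope: `Y` is injective and `f` is an essential
monomorphism. -/
structure IsInjectiveEnvelope {X Y : DualCoeff.{v, u} G} (f : X ⟶ Y) : Prop where
  injective : Injective Y
  mono : Mono f
  essential : ∀ (Z : DualCoeff.{v, u} G) (g : Y ⟶ Z), Mono (f ≫ g) → Mono g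

/-- A minimal injective resolution `V ⟶ V₀ ⟶ V₁ ⟶ ⋯`: every `V_i` is the injective envelope
of the cokernel of the preceding map. -/
structure MinInjResolution (V : DualCoeff.{v, u} G) where
  /-- the terms `V_i` -/
  obj : ℕ → DualCoeff.{v, u} G
  /-- the augmentation `V ⟶ V₀` -/
  aug : V ⟶ obj 0
  /-- the maps `w_i : V_i ⟶ V_{i+1}` -/
  w : ∀ i, obj i ⟶ obj (i + 1)
  aug_w : aug ≫ w 0 = 0
  w_w : ∀ i, w i ≫ w (i + 1) = 0
  envelope_aug : IsInjectiveEnvelope aug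
  envelope_zero : IsInjectiveEnvelope (cokernel.desc aug (w 0) aug_w)
  envelope_succ : ∀ i, IsInjectiveEnvelope (cokernel.desc (w i) (w (i + 1)) (w_w i))

/-- The elements of the DGAs `U(G/H)` that are the values of a map from a coefficient system
to the degree `i` part of the diagram `U`. -/
def values {F : DualCoeff.{v, u} G} {U : DGADiagram.{v, u} G} {i : ℕ}
    (η : F ⟶ U ⋙ CDGA.deg i) (H : OrbitCat G) : F.obj H →ₗ[ℚ] (U.obj H).carrier :=
  ((U.obj H).gr i).subtype ∘ₗ (η.app H).hom

/-! ## Elementary extensions -/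

/-- `ι : U ⟶ E`, together with elements `gen i x` of degree `n + i` for `x ∈ W i`, exhibits the
graded algebra `E` as `U ⊗ (⊗ᵢ ℚ(W i))`, where `ℚ(W i)` is the free graded commutative
algebra on the vector space `W i` placed in degree `n + i`: a morphism of graded algebras out of
`E` is the same as one out of `U` and degree preserving linear maps out of the `W i`. -/
def IsFreeExtension {U E : GCAlg.{u}} (ι : U ⟶ E) (n : ℕ) (W : ℕ → ModuleCat.{u} ℚ)
    (gen : ∀ i, W i →ₗ[ℚ] E.carrier) : Prop :=
  ∀ (B : GCAlg.{u}) (φ : U ⟶ B) (ψ : ∀ i, W i →ₗ[ℚ] B.gr (n + i)),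
    ∃! Φ : E ⟶ B, ι ≫ Φ = φ ∧
      ∀ i (x : W i), GCAlg.fn Φ (gen i x) = (ψ i x : B.carrier)

/-- The structure of an elementary extension `E = U^α(V)` of degree `n` on a morphism
`ι : U ⟶ E`: a coefficient system `V` (in degree `n`) with a map `α` from `V` to the
`(n+1)`-cocycles of `U`, a minimal injective resolution of `V`, maps `α_i` extending `α` along it
with `d α_i = α_{i+1} w_i`, such that `E` is freely generated over `U` by the `V_i` in
degrees `n + i`, with differential `d = (-1)^i α_i + w_i` on `V_i`. -/
structure ElementaryExtension (n : ℕ) {U E : DGADiagram.{v, u} G} (ι : U ⟶ E) where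
  /-- the coefficient system `V` -/
  V : DualCoeff.{v, u} G
  /-- the map `α` from `V` to the cocycles of degree `n + 1` -/
  α : V ⟶ U ⋙ CDGA.deg (n + 1)
  α_cocycle : ∀ (H : OrbitCat G) (x : V.obj H),
    (U.obj H).d (values α H x) = 0
  /-- the minimal injective resolution of `V` -/
  res : MinInjResolution V
  /-- the maps `α_i` -/
  αs : ∀ i, res.obj i ⟶ U ⋙ CDGA.deg (n + i + 1)
  αs_zero : res.aug ≫ αs 0 = α
  αs_succ : ∀ (i : ℕ) (H : OrbitCat G) (x : (res.obj i).obj H),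
    (U.obj H).d (values (αs i) H x) =
      values (αs (i + 1)) H (((res.w i).app H).hom x)
  /-- the inclusion of the generators `V_i` in degree `n + i` -/
  gen : ∀ i, res.obj i ⟶ E ⋙ CDGA.deg (n + i)
  d_gen : ∀ (i : ℕ) (H : OrbitCat G) (x : (res.obj i).obj H),
    (E.obj H).d (values (gen i) H x) =
      (-1 : ℚ) ^ i • CDGA.fn (ι.app H)
        (values (αs i) H x) +
      values (gen (i + 1)) H (((res.w i).app H).hom x)
  free : ∀ H : OrbitCat G, IsFreeExtension (CDGA.forgetD.map (ι.app H)) n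
    (fun i => (res.obj i).obj H) (fun i => values (gen i) H)

end Diagrams

/-! ## Minimal systems, minimal models and intrinsic formality -/

/-- A minimal system of DGAs: a system `M` which is the increasing union of systems
`M₀ = M₁ = ℚ ⊆ M₂ ⊆ M₃ ⊆ ⋯`, where `M_n` is, for `n ≥ 2`, an elementary extension of
`M_{n-1}` of degree `n`. -/
structure MinimalSystem (G : Type v) [Group G] where
  /-- the system `M` -/
  total : DGADiagram.{v, u} G
  /-- the stages `M_n` -/
  stage : ℕ → DGADiagram.{v, u} G
  /-- the inclusions `M_n ⟶ M_{n+1}` -/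
  incl : ∀ n, stage n ⟶ stage (n + 1)
  /-- the inclusions `M_n ⟶ M` -/
  toTotal : ∀ n, stage n ⟶ total
  total_isSystem : IsSystem total
  stage_isSystem : ∀ n, IsSystem (stage n)
  incl_toTotal : ∀ n, incl n ≫ toTotal (n + 1) = toTotal n
  toTotal_inclusion : ∀ n, IsInclusion (toTotal n)
  /-- `M` is the union of the stages -/
  union : ∀ (H : OrbitCat G) (x : (total.obj H).carrier),
    ∃ (n : ℕ) (y : ((stage n).obj H).carrier), CDGA.fn ((toTotal n).app H) y = x
  /-- `M₀` is the constant system `ℚ` -/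
  stage_zero : ∀ H : OrbitCat G,
    Function.Bijective (algebraMap ℚ ((stage 0).obj H).carrier)
  /-- `M₁ = M₀` -/
  stage_one : IsIso (incl 0)
  /-- `M_{n+2}` is an elementary extension of `M_{n+1}` of degree `n + 2` -/
  ext : ∀ n, ElementaryExtension (n + 2) (incl (n + 1))

section IntrinsicFormality

variable {G : Type v} [Group G]

/-- `M` is a minimal model of the diagram of graded algebras `A`: there are an injective
replacement `(A, 0) ⟶ U` (an inclusion into a system of DGAs that is a quasi-isomorphism, for
instance the identity if `A` itself is injective) and a quasi-isomorphism `M ⟶ U`. -/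
def IsMinimalModel (M : MinimalSystem.{v, u} G) (A : GADiagram.{v, u} G) : Prop :=
  ∃ (U : DGADiagram.{v, u} G) (j : A ⋙ GCAlg.zeroD ⟶ U) (ρ : M.total ⟶ U),
    IsSystem U ∧ IsInclusion j ∧ IsQuasiIso j ∧ IsQuasiIso ρ

/-- `A` is `k`-intrinsically formal: for any two minimal systems with cohomology `A` there is
a `k`-isomorphism between their `k`-th stages, in one of the two directions. -/
def IsKIntrinsicallyFormal (k : ℕ) (A : GADiagram.{v, u} G) : Prop :=
  ∀ M M' : MinimalSystem.{v, u} G,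
    Nonempty (cohomologyDiagram M.total ≅ A) → Nonempty (cohomologyDiagram M'.total ≅ A) →
      (∃ f : M.stage k ⟶ M'.stage k, IsKIso k f) ∨
      (∃ f : M'.stage k ⟶ M.stage k, IsKIso k f)

end IntrinsicFormality

end EquivFormal

end

noncomputable section

namespace EquivFormal

/-! ## Graded algebras from projections -/

/-! The point is that every minimal system `N` with cohomology `A`, and not only `M`, satisfies `N_n
= N_{n+1}`. Granting this, an `n`-isomorphism `N_n → N'_n` is also a map `N_{n+1} → N'_{n+1}`. It is
an `(n+1)`-isomorphism because the new conditions are vacuous: `H^{n+1}` of the target embeds in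
`A^{n+1} = 0`, and `H^{n+2}` of the source embeds in `A^{n+2} = 0`. Both embeddings hold because
`N_k → N` is onto in degrees `≤ k`, hence a `k`-isomorphism (`isoUpTo_toTotal`).

To see that `N_n = N_{n+1}`, let `V` be the coefficient system of this extension. If `H^{n+2}(N_n) =
0`, then `α` sends `x ∈ V` to a coboundary `du`, so `x - u` is a cocycle of degree `n + 1` in
`N_{n+1}`. As `H^{n+1}(N_{n+1}) = 0` it is a coboundary, of an element of degree `n`, which lies in
`N_n`. So the free generator `x` lies in `N_n`, and `x = 0` (`isZero_V`). By minimality the whole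
resolution of `V = 0` vanishes.

It remains to find `H^{n+2}(N_n) = 0`. For `M` this holds because `M_n = M_{n+1}` and
`H^{n+2}(M_{n+1})` embeds in `A^{n+2}`. It passes to `N` along the `n`-isomorphism given by
`n`-intrinsic formality. A map that is an isomorphism in cohomology up to degree `n` and injective
in degree `n + 1` lifts maps out of an `n`-th stage up to homotopy (`MinimalSystem.exists_lift`).
Lifting the identity gives a one-sided homotopy inverse, so vanishing transfers in every degree.
Vanishing can be tested at one orbit at a time, so the lift need not be natural.

The lifting theorem is obtained by factoring through a polynomial path object and solving for the
generators `V_0, V_1, …` in turn. The obstruction appears only on `V = ker w_0`. -/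

theorem isInternal_of_proj {R : Type*} [AddCommGroup R] [Module ℚ R] (gr : ℕ → Submodule ℚ R)
    (π : ℕ → R →ₗ[ℚ] R) (hmem : ∀ i x, π i x ∈ gr i)
    (hπ : ∀ i j x, x ∈ gr i → π j x = if i = j then x else 0)
    (hsum : ∀ x, ∃ N, ∀ k ≥ N, ∑ i ∈ Finset.range k, π i x = x) :
    DirectSum.IsInternal gr := by
  refine (DirectSum.isInternal_submodule_iff_iSupIndep_and_iSup_eq_top _).2 ⟨?_, ?_⟩
  · rw [iSupIndep_iff_finsetSum_eq_zero_imp_eq_zero]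
    intro s x hx hs j hj
    have h := congrArg (π j) hs
    rw [map_sum, map_zero, Finset.sum_eq_single j] at h
    · rwa [hπ j j _ (hx j hj), if_pos rfl] at h
    · intro i hi hij
      rw [hπ i j _ (hx i hi), if_neg hij]
    · exact fun h' => absurd hj h'
  · rw [eq_top_iff]
    rintro x -
    obtain ⟨N, hN⟩ := hsum x
    rw [← hN N le_rfl]
    exact Submodule.sum_mem _ fun i _ => Submodule.mem_iSup_of_mem i (hmem i x)

/-! ### Homogeneous components. -/

namespace GCAlg

variable {A B : GCAlg.{u}}

theorem proj_self {i : ℕ} {a : A.carrier} (h : a ∈ A.gr i) : A.proj i a = a := by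
  rw [A.proj_of_mem h, if_pos rfl]

theorem proj_of_ne {i j : ℕ} {a : A.carrier} (h : a ∈ A.gr i) (hij : i ≠ j) :
    A.proj j a = 0 := by
  rw [A.proj_of_mem h, if_neg hij]

theorem sum_proj (a : A.carrier) :
    ∃ N, ∀ k ≥ N, ∑ i ∈ Finset.range k, A.proj i a = a := by
  refine A.induction (p := fun a => ∃ N, ∀ k ≥ N, ∑ i ∈ Finset.range k, A.proj i a = a) a
    ⟨0, fun k _ => by simp only [map_zero, Finset.sum_const_zero]⟩ ?_ ?_
  · rintro a b ⟨N, hN⟩ ⟨N', hN'⟩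
    refine ⟨max N N', fun k hk => ?_⟩
    simp only [map_add, Finset.sum_add_distrib]
    rw [hN k (le_trans (le_max_left _ _) hk), hN' k (le_trans (le_max_right _ _) hk)]
  · intro i a ha
    refine ⟨i + 1, fun k hk => ?_⟩
    rw [Finset.sum_eq_single i, proj_self ha]
    · intro j _ hj
      exact proj_of_ne ha hj.symm
    · intro h
      exact absurd (Finset.mem_range.2 hk) h

theorem eq_zero_of_mem_of_mem {i j : ℕ} {a : A.carrier} (hi : a ∈ A.gr i) (hj : a ∈ A.gr j)
    (hij : i ≠ j) : a = 0 := by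
  rw [← proj_self hj, proj_of_ne hi hij]

/-- Additive maps agreeing on homogeneous elements agree. -/
theorem linearMap_ext {M : Type*} [AddCommGroup M] [Module ℚ M] {f g : A.carrier →ₗ[ℚ] M}
    (h : ∀ i, ∀ a ∈ A.gr i, f a = g a) (a : A.carrier) : f a = g a :=
  A.induction (p := fun a => f a = g a) a (by rw [map_zero, map_zero])
    (fun a b ha hb => by rw [map_add, map_add, ha, hb]) h

theorem fn_proj (f : A ⟶ B) (i : ℕ) (a : A.carrier) : fn f (A.proj i a) = B.proj i (fn f a) := by
  refine linearMap_ext (f := (fn f).toLinearMap ∘ₗ A.proj i)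
    (g := B.proj i ∘ₗ (fn f).toLinearMap) ?_ a
  intro j a ha
  have h := GCAlg.Hom.map_gr f j a ha
  change fn f (A.proj i a) = B.proj i (fn f a)
  rw [A.proj_of_mem ha, B.proj_of_mem (i := j) (a := fn f a) h]
  split_ifs
  · rfl
  · exact map_zero _

theorem one_mem_gr : (1 : A.carrier) ∈ A.gr 0 := SetLike.GradedOne.one_mem (A := A.gr)

theorem mul_mem_gr {i j : ℕ} {a b : A.carrier} (ha : a ∈ A.gr i) (hb : b ∈ A.gr j) :
    a * b ∈ A.gr (i + j) := SetLike.GradedMul.mul_mem (A := A.gr) ha hb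

theorem algebraMap_mem_gr (q : ℚ) : algebraMap ℚ A.carrier q ∈ A.gr 0 := by
  rw [Algebra.algebraMap_eq_smul_one]
  exact Submodule.smul_mem _ _ one_mem_gr

/-- Components of a product in degree `i` involve only components of the factors in degrees `≤ i`;
this makes conditions on low degrees stable under multiplication. -/
theorem proj_mul (i : ℕ) (a b : A.carrier) :
    A.proj i (a * b) = ∑ j ∈ Finset.range (i + 1), A.proj j a * A.proj (i - j) b := by
  refine A.induction (p := fun a => A.proj i (a * b) = ∑ j ∈ Finset.range (i + 1),
    A.proj j a * A.proj (i - j) b) a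
    (by simp only [zero_mul, map_zero, Finset.sum_const_zero])
    (fun x y hx hy => by simp only [add_mul, map_add, hx, hy, Finset.sum_add_distrib]) ?_
  intro k a ha
  refine A.induction (p := fun b => A.proj i (a * b) = ∑ j ∈ Finset.range (i + 1),
    A.proj j a * A.proj (i - j) b) b
    (by simp only [mul_zero, map_zero, Finset.sum_const_zero])
    (fun x y hx hy => by simp only [mul_add, map_add, hx, hy, Finset.sum_add_distrib]) ?_
  intro l b hb
  by_cases hk : k ≤ i
  · rw [Finset.sum_eq_single k]
    · rw [proj_self ha, A.proj_of_mem (mul_mem_gr ha hb), A.proj_of_mem hb]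
      by_cases h : k + l = i
      · rw [if_pos h, if_pos (by omega)]
      · rw [if_neg h, if_neg (by omega), mul_zero]
    · intro j _ hj
      rw [proj_of_ne ha hj.symm, zero_mul]
    · intro h
      exact absurd (Finset.mem_range.2 (by omega)) h
  · rw [proj_of_ne (mul_mem_gr ha hb) (by omega), Finset.sum_eq_zero]
    intro j hj
    rw [proj_of_ne ha (by have := Finset.mem_range.1 hj; omega), zero_mul]

/-! ### The sign automorphism -/

variable (A) in
/-- The linear map `a ↦ (-1)^(e * i) a` for `a` of degree `i`. -/
def signLin (e : ℕ) : A.carrier →ₗ[ℚ] A.carrier :=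
  DirectSum.toModule ℚ ℕ A.carrier (fun i => (-1 : ℚ) ^ (e * i) • (A.gr i).subtype) ∘ₗ
    A.decomp.toLinearMap

theorem signLin_of_mem (e : ℕ) {i : ℕ} {a : A.carrier} (h : a ∈ A.gr i) :
    A.signLin e a = (-1 : ℚ) ^ (e * i) • a := by
  rw [signLin, LinearMap.comp_apply, LinearEquiv.coe_coe, A.decomp_of_mem h,
    DirectSum.toModule_lof]
  rfl

variable (A) in
/-- The automorphism `a ↦ (-1)^(e * i) a` for `a` of degree `i`. -/
def sign (e : ℕ) : A.carrier →ₐ[ℚ] A.carrier :=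
  AlgHom.ofLinearMap (A.signLin e)
    (by rw [signLin_of_mem e one_mem_gr, mul_zero, pow_zero, one_smul]) (by
    intro a b
    refine A.induction (p := fun a => A.signLin e (a * b) = A.signLin e a * A.signLin e b) a
      (by simp only [zero_mul, map_zero])
      (fun x y hx hy => by simp only [add_mul, map_add, hx, hy]) ?_
    intro i a ha
    refine A.induction (p := fun b => A.signLin e (a * b) = A.signLin e a * A.signLin e b) b
      (by simp only [mul_zero, map_zero])
      (fun x y hx hy => by simp only [mul_add, map_add, hx, hy]) ?_
    intro j b hb
    rw [signLin_of_mem e ha, signLin_of_mem e hb, signLin_of_mem e (mul_mem_gr ha hb),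
      smul_mul_smul_comm, mul_add, pow_add])

theorem sign_of_mem (e : ℕ) {i : ℕ} {a : A.carrier} (h : a ∈ A.gr i) :
    A.sign e a = (-1 : ℚ) ^ (e * i) • a := signLin_of_mem e h

theorem sign_mem (e : ℕ) {i : ℕ} {a : A.carrier} (h : a ∈ A.gr i) : A.sign e a ∈ A.gr i := by
  rw [sign_of_mem e h]
  exact Submodule.smul_mem _ _ h

theorem fn_sign (f : A ⟶ B) (e : ℕ) (a : A.carrier) :
    fn f (A.sign e a) = B.sign e (fn f a) := by
  refine linearMap_ext (f := (fn f).toLinearMap ∘ₗ (A.sign e).toLinearMap)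
    (g := (B.sign e).toLinearMap ∘ₗ (fn f).toLinearMap) ?_ a
  intro j a ha
  change fn f (A.sign e a) = B.sign e (fn f a)
  rw [sign_of_mem e ha, sign_of_mem (i := j) (a := fn f a) e (GCAlg.Hom.map_gr f j a ha), map_smul]

/-! ### Graded subalgebras -/

variable (A) in
/-- A subalgebra stable under the projections to the homogeneous parts, as a graded algebra. -/
def sub (S : Subalgebra ℚ A.carrier) (hS : ∀ i, ∀ a ∈ S, A.proj i a ∈ S) : GCAlg.{u} where
  carrier := S
  gr i := (A.gr i).comap S.val.toLinearMap
  gradedMonoid :=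
    { one_mem := one_mem_gr
      mul_mem := fun _ _ _ _ ha hb => mul_mem_gr ha hb }
  isInternal := by
    refine isInternal_of_proj _
      (fun i => (A.proj i).restrict (p := Subalgebra.toSubmodule S)
        (q := Subalgebra.toSubmodule S) (hS i)) ?_ ?_ ?_
    · exact fun i x => A.proj_mem i x
    · intro i j x hx
      refine Subtype.ext ((A.proj_of_mem hx j).trans ?_)
      split_ifs <;> rfl
    · intro x
      obtain ⟨N, hN⟩ := A.sum_proj (x : A.carrier)
      refine ⟨N, fun k hk => Subtype.ext ?_⟩
      rw [← hN k hk]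
      exact map_sum S.val _ _
  comm i j a b ha hb := Subtype.ext (A.comm i j a b ha hb)

/-- The inclusion of a graded subalgebra. -/
def subVal (S : Subalgebra ℚ A.carrier) (hS : ∀ i, ∀ a ∈ S, A.proj i a ∈ S) : A.sub S hS ⟶ A :=
  (⟨S.val, fun _ _ h => h⟩ : GCAlg.Hom _ _)

/-! ### Bijective morphisms -/

theorem hom_ext {f g : A ⟶ B} (h : ∀ a, fn f a = fn g a) : f = g :=
  GCAlg.Hom.ext (AlgHom.ext h)

theorem mem_gr_of_fn_mem {f : A ⟶ B} (hf : Function.Injective (fn f)) {i : ℕ} {a : A.carrier}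
    (h : fn f a ∈ B.gr i) : a ∈ A.gr i := by
  have : A.proj i a = a := hf (by rw [fn_proj, proj_self h])
  exact this ▸ A.proj_mem i a

/-- The inverse of a bijective morphism. -/
def invHom (f : A ⟶ B) (hf : Function.Bijective (fn f)) : B ⟶ A :=
  (⟨(AlgEquiv.ofBijective (fn f) hf).symm.toAlgHom, fun i b hb =>
    mem_gr_of_fn_mem hf.1 (i := i) (by
      change fn f ((AlgEquiv.ofBijective (fn f) hf).symm b) ∈ B.gr i
      have := (AlgEquiv.ofBijective (fn f) hf).apply_symm_apply b
      rw [AlgEquiv.coe_ofBijective] at this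
      rwa [this])⟩ : GCAlg.Hom _ _)

theorem isIso_of_bijective (f : A ⟶ B) (hf : Function.Bijective (fn f)) : IsIso f :=
  ⟨invHom f hf, hom_ext fun a => (AlgEquiv.ofBijective (fn f) hf).symm_apply_apply a,
    hom_ext fun b => (AlgEquiv.ofBijective (fn f) hf).apply_symm_apply b⟩

end GCAlg

/-! ### Morphisms of DGAs and the Leibniz rule without homogeneity. -/

namespace CDGA

variable {A B : CDGA.{u}}

theorem hom_ext {f g : A ⟶ B} (h : ∀ a, fn f a = fn g a) : f = g :=
  CDGA.Hom.ext (AlgHom.ext h)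

theorem fn_mem (f : A ⟶ B) {i : ℕ} {a : A.carrier} (h : a ∈ A.gr i) : fn f a ∈ B.gr i :=
  (CDGA.Hom.toHom f).map_gr i a h

theorem fn_comp {C : CDGA.{u}} (f : A ⟶ B) (g : B ⟶ C) (a : A.carrier) :
    fn (f ≫ g) a = fn g (fn f a) := rfl

theorem fn_id (a : A.carrier) : fn (𝟙 A) a = a := rfl

theorem isIso_of_bijective (f : A ⟶ B) (hf : Function.Bijective (fn f)) : IsIso f := by
  refine ⟨(⟨GCAlg.invHom (CDGA.Hom.toHom f : A.toGCAlg ⟶ B.toGCAlg) hf, fun b => hf.1 ?_⟩ : CDGA.Hom B A),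
    hom_ext fun a => (AlgEquiv.ofBijective (fn f) hf).symm_apply_apply a,
    hom_ext fun b => (AlgEquiv.ofBijective (fn f) hf).apply_symm_apply b⟩
  rw [fn_d]
  have h := (AlgEquiv.ofBijective (fn f) hf).apply_symm_apply
  exact (h (B.d b)).trans (congrArg B.d (h b).symm)

/-- With the sign absorbed into an automorphism, the rule applies to inhomogeneous elements, so the
locus where an algebra map commutes with `d` is visibly a subalgebra. -/
theorem leibniz_sign (a b : A.carrier) : A.d (a * b) = A.d a * b + A.sign 1 a * A.d b := by
  refine A.toGCAlg.induction (p := fun a => A.d (a * b) = A.d a * b + A.sign 1 a * A.d b) a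
    (by simp only [zero_mul, map_zero, add_zero])
    (fun x y hx hy => by simp only [add_mul, map_add, hx, hy]; abel) ?_
  intro i a ha
  rw [A.leibniz i a b ha, GCAlg.sign_of_mem 1 ha, one_mul, smul_mul_assoc]

theorem sign_d (a : A.carrier) : A.sign 1 (A.d a) = - A.d (A.sign 1 a) := by
  refine GCAlg.linearMap_ext (A := A.toGCAlg) (f := (A.sign 1).toLinearMap ∘ₗ A.d)
    (g := - (A.d ∘ₗ (A.sign 1).toLinearMap)) ?_ a
  intro i a ha
  change A.sign 1 (A.d a) = - A.d (A.sign 1 a)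
  rw [GCAlg.sign_of_mem 1 ha, GCAlg.sign_of_mem 1 (A.d_mem i a ha), map_smul, one_mul, one_mul,
    pow_succ, mul_neg_one, neg_smul]

end CDGA

/-! ## The algebra `C ⊕ εC` -/

namespace GCAlg

variable (C : GCAlg.{u}) (e : ℕ)

/-- The underlying space of the algebra `C ⊕ εC`, where `ε` has degree `e` and `ε² = 0`. -/
def Twist (_ : ℕ) : Type u := C.carrier × C.carrier

namespace Twist

instance : AddCommGroup (C.Twist e) := inferInstanceAs (AddCommGroup (C.carrier × C.carrier))

instance : Module ℚ (C.Twist e) := inferInstanceAs (Module ℚ (C.carrier × C.carrier))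

variable {C e}

theorem ext {x y : C.Twist e} (h1 : x.1 = y.1) (h2 : x.2 = y.2) : x = y := Prod.ext h1 h2

/-- The pair `(a, b)` stands for `a + εb`; moving `ε` to the left past `a` costs `(-1)^(e|a|)`. The
construction serves twice: as a test algebra detecting free generators, and with `ε = dt` for the
path object. -/
instance : Mul (C.Twist e) := ⟨fun x y => (x.1 * y.1, x.2 * y.1 + C.sign e x.1 * y.2)⟩

instance : One (C.Twist e) := ⟨(1, 0)⟩

theorem mul_snd (x y : C.Twist e) : (x * y).2 = x.2 * y.1 + C.sign e x.1 * y.2 := rfl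

theorem smul_snd (q : ℚ) (x : C.Twist e) : (q • x).2 = q • x.2 := rfl

instance : Ring (C.Twist e) :=
  { (inferInstance : AddCommGroup (C.Twist e)) with
    mul := (· * ·)
    one := 1
    left_distrib := fun a b c => ext (mul_add _ _ _) (by
      change a.2 * (b.1 + c.1) + C.sign e a.1 * (b.2 + c.2) =
        (a.2 * b.1 + C.sign e a.1 * b.2) + (a.2 * c.1 + C.sign e a.1 * c.2)
      rw [mul_add, mul_add]; abel)
    right_distrib := fun a b c => ext (add_mul _ _ _) (by
      change (a.2 + b.2) * c.1 + C.sign e (a.1 + b.1) * c.2 =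
        (a.2 * c.1 + C.sign e a.1 * c.2) + (b.2 * c.1 + C.sign e b.1 * c.2)
      rw [add_mul, map_add, add_mul]; abel)
    zero_mul := fun a => ext (zero_mul _) (by
      change (0 : C.carrier) * a.1 + C.sign e 0 * a.2 = 0
      rw [zero_mul, map_zero, zero_mul, add_zero])
    mul_zero := fun a => ext (mul_zero _) (by
      change a.2 * 0 + C.sign e a.1 * 0 = 0
      rw [mul_zero, mul_zero, add_zero])
    mul_assoc := fun a b c => ext (mul_assoc _ _ _) (by
      change (a.2 * b.1 + C.sign e a.1 * b.2) * c.1 + C.sign e (a.1 * b.1) * c.2 =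
        a.2 * (b.1 * c.1) + C.sign e a.1 * (b.2 * c.1 + C.sign e b.1 * c.2)
      rw [map_mul]; noncomm_ring)
    one_mul := fun a => ext (one_mul _) (by
      change 0 * a.1 + C.sign e 1 * a.2 = a.2
      rw [map_one, one_mul, zero_mul, zero_add])
    mul_one := fun a => ext (mul_one _) (by
      change a.2 * 1 + C.sign e a.1 * 0 = a.2
      rw [mul_one, mul_zero, add_zero]) }

instance : Algebra ℚ (C.Twist e) :=
  Algebra.ofModule
    (fun r x y => ext (smul_mul_assoc r x.1 y.1) (by
      change (r • x.2) * y.1 + C.sign e (r • x.1) * y.2 = r • (x.2 * y.1 + C.sign e x.1 * y.2)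
      rw [map_smul, smul_mul_assoc, smul_mul_assoc, smul_add]))
    (fun r x y => ext (mul_smul_comm r x.1 y.1) (by
      change x.2 * (r • y.1) + C.sign e x.1 * (r • y.2) = r • (x.2 * y.1 + C.sign e x.1 * y.2)
      rw [mul_smul_comm, mul_smul_comm, smul_add]))

end Twist

/-- The homogeneous parts of the shift `εC`. -/
def shiftGr (i : ℕ) : Submodule ℚ C.carrier := if e ≤ i then C.gr (i - e) else ⊥

/-- The projections of the shift `εC` to its homogeneous parts. -/
def shiftProj (i : ℕ) : C.carrier →ₗ[ℚ] C.carrier := if e ≤ i then C.proj (i - e) else 0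

variable {C} in
theorem mem_shiftGr {i : ℕ} {a : C.carrier} :
    a ∈ C.shiftGr e i ↔ a = 0 ∨ ∃ k, i = e + k ∧ a ∈ C.gr k := by
  unfold shiftGr
  split_ifs with h
  · constructor
    · exact fun ha => Or.inr ⟨i - e, by omega, ha⟩
    · rintro (rfl | ⟨k, rfl, hk⟩)
      · exact Submodule.zero_mem _
      · rwa [Nat.add_sub_cancel_left]
  · rw [Submodule.mem_bot]
    refine ⟨Or.inl, ?_⟩
    rintro (h0 | ⟨k, rfl, -⟩)
    · exact h0
    · omega

variable {C} in
theorem mem_shiftGr_add {k : ℕ} {a : C.carrier} : a ∈ C.shiftGr e (e + k) ↔ a ∈ C.gr k := by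
  rw [shiftGr, if_pos (Nat.le_add_right e k), Nat.add_sub_cancel_left]

theorem shiftProj_mem (i : ℕ) (a : C.carrier) : C.shiftProj e i a ∈ C.shiftGr e i := by
  unfold shiftProj shiftGr
  split_ifs
  · exact C.proj_mem _ _
  · exact Submodule.zero_mem _

theorem shiftProj_of_mem {i : ℕ} {a : C.carrier} (h : a ∈ C.shiftGr e i) (j : ℕ) :
    C.shiftProj e j a = if i = j then a else 0 := by
  obtain rfl | ⟨k, rfl, hk⟩ := (mem_shiftGr e).1 h
  · rw [map_zero, ite_self]
  · unfold shiftProj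
    split_ifs with h1 h2 h2
    · subst h2
      rw [Nat.add_sub_cancel_left, proj_self hk]
    · exact proj_of_ne hk (by omega)
    · omega
    · rfl

theorem sum_shiftProj (a : C.carrier) :
    ∃ N, ∀ k ≥ N, ∑ i ∈ Finset.range k, C.shiftProj e i a = a := by
  obtain ⟨N, hN⟩ := C.sum_proj a
  refine ⟨N + e, fun k hk => ?_⟩
  obtain ⟨l, rfl⟩ := Nat.exists_eq_add_of_le (show e ≤ k by omega)
  rw [Finset.sum_range_add, Finset.sum_eq_zero, zero_add]
  · rw [← hN l (by omega)]
    refine Finset.sum_congr rfl fun i _ => ?_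
    rw [hN l (by omega), shiftProj, if_pos (Nat.le_add_right e i), Nat.add_sub_cancel_left]
  · intro i hi
    rw [shiftProj, if_neg (by have := Finset.mem_range.1 hi; omega), LinearMap.zero_apply]

variable {C e} in
theorem mul_mem_shiftGr {i j : ℕ} {a b : C.carrier} (ha : a ∈ C.gr i) (hb : b ∈ C.shiftGr e j) :
    a * b ∈ C.shiftGr e (i + j) := by
  obtain rfl | ⟨k, rfl, hk⟩ := (mem_shiftGr e).1 hb
  · rw [mul_zero]; exact Submodule.zero_mem _
  · rw [show i + (e + k) = e + (i + k) by omega, mem_shiftGr_add]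
    exact mul_mem_gr ha hk

variable {C e} in
theorem mul_mem_shiftGr' {i j : ℕ} {a b : C.carrier} (ha : a ∈ C.shiftGr e i) (hb : b ∈ C.gr j) :
    a * b ∈ C.shiftGr e (i + j) := by
  obtain rfl | ⟨k, rfl, hk⟩ := (mem_shiftGr e).1 ha
  · rw [zero_mul]; exact Submodule.zero_mem _
  · rw [add_assoc, mem_shiftGr_add]
    exact mul_mem_gr hk hb

/-- The homogeneous parts of `C ⊕ εC`. -/
def twistGr (i : ℕ) : Submodule ℚ (C.Twist e) :=
  Submodule.prod (C.gr i) (C.shiftGr e i)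

/-- The projections of `C ⊕ εC` to its homogeneous parts. -/
def twistProj (i : ℕ) : C.Twist e →ₗ[ℚ] C.Twist e :=
  LinearMap.prodMap (C.proj i) (C.shiftProj e i)

variable {C e} in
theorem neg_one_shift {k j : ℕ} (a b : C.carrier) (ha : a ∈ C.gr k) (hb : b ∈ C.gr j) :
    a * b = (-1 : ℚ) ^ ((e + k) * j) • (C.sign e b * a) := by
  rw [C.comm k j a b ha hb, sign_of_mem e hb, smul_mul_assoc, smul_smul, ← pow_add,
    show (e + k) * j + e * j = k * j + 2 * (e * j) by ring, pow_add (-1 : ℚ) (k * j), pow_mul (-1 : ℚ) 2]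
  norm_num

variable {C e} in
theorem sign_mul_shift {k i : ℕ} (a b : C.carrier) (ha : a ∈ C.gr i) (hb : b ∈ C.gr k) :
    C.sign e a * b = (-1 : ℚ) ^ (i * (e + k)) • (b * a) := by
  rw [sign_of_mem e ha, smul_mul_assoc, C.comm i k a b ha hb, smul_smul, ← pow_add]
  ring_nf

/-- The graded algebra `C ⊕ εC`, where `ε` has degree `e` and `ε² = 0`. -/
def twist : GCAlg.{u} where
  carrier := C.Twist e
  gr := C.twistGr e
  gradedMonoid :=
    { one_mem := ⟨one_mem_gr, Submodule.zero_mem _⟩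
      mul_mem := fun _ _ _ _ ha hb => ⟨mul_mem_gr ha.1 hb.1, Submodule.add_mem _
        (mul_mem_shiftGr' ha.2 hb.1) (mul_mem_shiftGr (sign_mem e ha.1) hb.2)⟩ }
  isInternal := by
    refine isInternal_of_proj _ (C.twistProj e) ?_ ?_ ?_
    · exact fun i x => ⟨C.proj_mem i x.1, C.shiftProj_mem e i x.2⟩
    · intro i j x hx
      refine Twist.ext ((C.proj_of_mem hx.1 j).trans ?_)
        ((C.shiftProj_of_mem e hx.2 j).trans ?_) <;> split_ifs <;> rfl
    · intro x
      obtain ⟨N, hN⟩ := C.sum_proj x.1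
      obtain ⟨N', hN'⟩ := C.sum_shiftProj e x.2
      refine ⟨max N N', fun k hk => Twist.ext ?_ ?_⟩
      · refine (map_sum (LinearMap.fst ℚ C.carrier C.carrier) _ _).trans ?_
        exact hN k (le_trans (le_max_left _ _) hk)
      · refine (map_sum (LinearMap.snd ℚ C.carrier C.carrier) _ _).trans ?_
        exact hN' k (le_trans (le_max_right _ _) hk)
  comm i j a b ha hb := by
    refine Twist.ext (C.comm i j a.1 b.1 ha.1 hb.1) ?_
    rw [Twist.mul_snd, Twist.smul_snd, Twist.mul_snd, smul_add, add_comm]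
    congr 1
    · obtain h | ⟨k, rfl, hk⟩ := (mem_shiftGr e).1 hb.2
      · rw [h]; simp only [zero_mul, mul_zero, smul_zero]
      · exact sign_mul_shift _ _ ha.1 hk
    · obtain h | ⟨k, rfl, hk⟩ := (mem_shiftGr e).1 ha.2
      · rw [h]; simp only [zero_mul, mul_zero, smul_zero]
      · exact neg_one_shift _ _ hk hb.1

/-- The inclusion of `C` into `C ⊕ εC`. -/
def twistInlHom : C.carrier →ₐ[ℚ] C.Twist e :=
  AlgHom.ofLinearMap (LinearMap.inl ℚ C.carrier C.carrier : C.carrier →ₗ[ℚ] C.Twist e) rfl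
    (fun a b => Twist.ext (e := e) rfl (by
      change 0 = 0 * b + C.sign e a * 0
      rw [zero_mul, mul_zero, add_zero]))

/-- The inclusion of `C` into `C ⊕ εC`, as a morphism of graded algebras. -/
def twistInl : C ⟶ C.twist e :=
  (⟨C.twistInlHom e, fun _ _ h => ⟨h, Submodule.zero_mem _⟩⟩ : GCAlg.Hom C (C.twist e))

end GCAlg

/-! ## Free extensions -/

namespace IsFreeExtension

variable {U E : GCAlg.{u}} {ι : U ⟶ E} {n : ℕ} {W : ℕ → ModuleCat.{u} ℚ}
  {gen : ∀ i, W i →ₗ[ℚ] E.carrier}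

/-- The base of a free extension is a retract. -/
theorem injective (h : IsFreeExtension ι n W gen) : Function.Injective (GCAlg.fn ι) := by
  obtain ⟨Φ, ⟨hΦ, -⟩, -⟩ := h U (𝟙 U) (fun _ => 0)
  intro a b hab
  have key : ∀ a, GCAlg.fn Φ (GCAlg.fn ι a) = a := fun a =>
    congrArg (fun f : U ⟶ U => GCAlg.fn f a) hΦ
  rw [← key a, ← key b, hab]

/-- A free extension is generated by its base and its generators. -/
theorem mem_of_generated (h : IsFreeExtension ι n W gen) (hgen : ∀ i x, gen i x ∈ E.gr (n + i))
    (S : Subalgebra ℚ E.carrier) (hS : ∀ i, ∀ a ∈ S, E.proj i a ∈ S)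
    (hU : ∀ u, GCAlg.fn ι u ∈ S) (hg : ∀ i x, gen i x ∈ S) (a : E.carrier) : a ∈ S := by
  let φ : U ⟶ E.sub S hS :=
    (⟨(GCAlg.fn ι).codRestrict S hU, fun i a ha => GCAlg.Hom.map_gr ι i a ha⟩ :
      GCAlg.Hom U (E.sub S hS))
  let ψ : ∀ i, W i →ₗ[ℚ] (E.sub S hS).gr (n + i) := fun i =>
    LinearMap.codRestrict _ (LinearMap.codRestrict (Subalgebra.toSubmodule S) (gen i) (hg i))
      (hgen i)
  obtain ⟨Φ, ⟨hΦ, hΦg⟩, -⟩ := h _ φ ψ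
  obtain ⟨Ψ, -, huniq⟩ := h E ι (fun i => LinearMap.codRestrict _ (gen i) (hgen i))
  -- The composite `E → S → E` and the identity agree on the base and on the generators, so
  -- uniqueness identifies them.
  have h1 : Φ ≫ GCAlg.subVal S hS = 𝟙 E := by
    rw [huniq (Φ ≫ GCAlg.subVal S hS), huniq (𝟙 E)]
    · exact ⟨Category.comp_id ι, fun i x => rfl⟩
    · refine ⟨?_, fun i x => ?_⟩
      · rw [← Category.assoc, hΦ]
        rfl
      · exact congrArg (fun y : S => (y : E.carrier)) (hΦg i x)
  have h2 : (show S from GCAlg.fn Φ a : E.carrier) = a :=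
    congrArg (fun f : E ⟶ E => GCAlg.fn f a) h1
  exact h2 ▸ (show S from GCAlg.fn Φ a).2

/-- In degrees below those of the generators, a free extension agrees with its base. -/
theorem mem_range_of_lt (h : IsFreeExtension ι n W gen) (hgen : ∀ i x, gen i x ∈ E.gr (n + i))
    {j : ℕ} (hj : j < n) {a : E.carrier} (ha : a ∈ E.gr j) : ∃ u ∈ U.gr j, GCAlg.fn ι u = a := by
  -- `S` consists of the elements whose components below degree `n` come from the base. It contains
  -- the generators, whose degrees are at least `n`.
  let S : Subalgebra ℚ E.carrier :=
    { carrier := {a | ∀ j < n, E.proj j a ∈ (GCAlg.fn ι).range}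
      mul_mem' := by
        intro a b ha hb j hj
        rw [GCAlg.proj_mul]
        refine Subalgebra.sum_mem _ fun i hi => ?_
        have := Finset.mem_range.1 hi
        exact Subalgebra.mul_mem _ (ha _ (by omega)) (hb _ (by omega))
      add_mem' := by
        intro a b ha hb j hj
        rw [map_add]
        exact Subalgebra.add_mem _ (ha j hj) (hb j hj)
      algebraMap_mem' := by
        intro r j _
        rw [E.proj_of_mem (GCAlg.algebraMap_mem_gr r)]
        split_ifs
        · exact Subalgebra.algebraMap_mem _ r
        · exact Subalgebra.zero_mem _ }
  have hmem : a ∈ S := by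
    refine h.mem_of_generated hgen S ?_ ?_ ?_ a
    · intro i a ha j hj
      rw [E.proj_of_mem (E.proj_mem i a)]
      split_ifs with hij
      · exact ha i (hij ▸ hj)
      · exact Subalgebra.zero_mem _
    · intro u j _
      exact ⟨U.proj j u, GCAlg.fn_proj ι j u⟩
    · intro i x j hj
      rw [GCAlg.proj_of_ne (hgen i x) (by omega)]
      exact Subalgebra.zero_mem _
  obtain ⟨u, hu⟩ := hmem j hj
  rw [GCAlg.proj_self ha] at hu
  have hu' : GCAlg.fn ι u = a := hu
  exact ⟨u, GCAlg.mem_gr_of_fn_mem h.injective (hu' ▸ ha), hu'⟩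

/-- A generator lies in the base only if it is zero. -/
theorem eq_zero_of_gen_mem_range (h : IsFreeExtension ι n W gen) [Nontrivial U.carrier]
    {i : ℕ} {x : W i} {u : U.carrier} (hx : gen i x = GCAlg.fn ι u) : x = 0 := by
  classical
  by_contra hne
  obtain ⟨l, hl⟩ : ∃ l : W i →ₗ[ℚ] ℚ, l x = 1 := Module.Projective.exists_dual_eq_one ℚ hne
  let l' : ∀ j, W j →ₗ[ℚ] ℚ := Pi.single i l
  -- Test algebra `U ⊕ εU` with `ε` in the degree of `x`: the base maps to the first summand and `x`
  -- to `ε l(x)`. If `x` comes from the base, its `ε`-part `l(x) = 1` must vanish.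
  let ψ : ∀ j, W j →ₗ[ℚ] (U.twist (n + i)).gr (n + j) := fun j =>
    LinearMap.codRestrict _
      ((LinearMap.inr ℚ U.carrier U.carrier : U.carrier →ₗ[ℚ] U.Twist (n + i)) ∘ₗ
        (l' j).smulRight (1 : U.carrier)) (by
      refine fun y => ⟨Submodule.zero_mem _, ?_⟩
      change l' j y • (1 : U.carrier) ∈ U.shiftGr (n + i) (n + j)
      obtain rfl | hij := eq_or_ne j i
      · exact Submodule.smul_mem _ _ ((GCAlg.mem_shiftGr_add (n + j) (k := 0)).2 GCAlg.one_mem_gr)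
      · rw [show l' j = 0 from Pi.single_eq_of_ne (M := fun j => W j →ₗ[ℚ] ℚ) hij l, LinearMap.zero_apply, zero_smul]
        exact Submodule.zero_mem _)
  obtain ⟨Φ, ⟨hΦ, hΦg⟩, -⟩ := h _ (U.twistInl (n + i)) ψ
  have h1 : GCAlg.fn Φ (GCAlg.fn ι u) = GCAlg.fn (U.twistInl (n + i)) u :=
    congrArg (fun f : U ⟶ U.twist (n + i) => GCAlg.fn f u) hΦ
  rw [← hx, hΦg i x] at h1
  have h2 : l' i x • (1 : U.carrier) = 0 := congrArg (Prod.snd : U.carrier × U.carrier → _) h1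
  rw [show l' i = l from Pi.single_eq_same (M := fun j => W j →ₗ[ℚ] ℚ) i l, hl, one_smul] at h2
  exact one_ne_zero h2

end IsFreeExtension

/-! ## Polynomials with coefficients in a DGA -/

section PolynomialPaths

open TensorProduct Polynomial

/-- The antiderivative of a rational polynomial that vanishes at `0`. -/
def antiderivative : ℚ[X] →ₗ[ℚ] ℚ[X] :=
  Polynomial.lsum fun n => ((n : ℚ) + 1)⁻¹ • Polynomial.monomial (n + 1)

theorem antiderivative_monomial (n : ℕ) (q : ℚ) :
    antiderivative (Polynomial.monomial n q) = Polynomial.monomial (n + 1) (((n : ℚ) + 1)⁻¹ * q) := by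
  rw [antiderivative, Polynomial.lsum_apply, Polynomial.sum_monomial_index _ _ (by simp)]
  simp [Polynomial.smul_monomial]

theorem derivative_antiderivative (p : ℚ[X]) : derivative (antiderivative p) = p := by
  induction p using Polynomial.induction_on' with
  | add p q hp hq => rw [map_add, map_add, hp, hq]
  | monomial n a =>
    rw [antiderivative_monomial, derivative_monomial]
    congr 1
    have : (n : ℚ) + 1 ≠ 0 := by positivity
    push_cast
    field_simp

theorem eval_zero_antiderivative (p : ℚ[X]) : (antiderivative p).eval 0 = 0 := by
  induction p using Polynomial.induction_on' with
  | add p q hp hq => rw [map_add, eval_add, hp, hq, add_zero]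
  | monomial n a => simp [antiderivative_monomial]

theorem antiderivative_derivative (p : ℚ[X]) :
    antiderivative (derivative p) = p - C (p.eval 0) := by
  induction p using Polynomial.induction_on' with
  | add p q hp hq => rw [map_add, map_add, hp, hq, eval_add, C_add]; abel
  | monomial n a =>
    cases n with
    | zero => simp
    | succ n =>
      rw [derivative_monomial, antiderivative_monomial]
      have : (n : ℚ) + 1 ≠ 0 := by positivity
      simp only [Nat.add_sub_cancel, eval_monomial, ne_eq, Nat.add_eq_zero_iff, one_ne_zero,
        and_false, not_false_eq_true, zero_pow, mul_zero, C_0, sub_zero]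
      congr 1
      push_cast
      field_simp

namespace GCAlg

variable (B : GCAlg.{u})

/-- The homogeneous parts of `B[t]`. -/
def polyGr (i : ℕ) : Submodule ℚ (ℚ[X] ⊗[ℚ] B.carrier) := LinearMap.range ((B.proj i).lTensor ℚ[X])

variable {B}

theorem tmul_mem_polyGr {i : ℕ} (p : ℚ[X]) {b : B.carrier} (h : b ∈ B.gr i) :
    p ⊗ₜ b ∈ B.polyGr i := ⟨p ⊗ₜ b, by rw [LinearMap.lTensor_tmul, proj_self h]⟩

theorem polyGr_induction {i : ℕ} {P : ℚ[X] ⊗[ℚ] B.carrier → Prop} {x : ℚ[X] ⊗[ℚ] B.carrier}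
    (hx : x ∈ B.polyGr i) (h0 : P 0) (hadd : ∀ x y, P x → P y → P (x + y))
    (ht : ∀ p, ∀ b ∈ B.gr i, P (p ⊗ₜ b)) : P x := by
  obtain ⟨y, rfl⟩ := hx
  induction y using TensorProduct.induction_on with
  | zero => rwa [map_zero]
  | tmul p b => exact ht p _ (B.proj_mem i b)
  | add x y hx hy => rw [map_add]; exact hadd _ _ hx hy

theorem proj_of_mem_polyGr {i : ℕ} {x : ℚ[X] ⊗[ℚ] B.carrier} (hx : x ∈ B.polyGr i) (j : ℕ) :
    (B.proj j).lTensor ℚ[X] x = if i = j then x else 0 := by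
  refine polyGr_induction (P := fun x => (B.proj j).lTensor ℚ[X] x = if i = j then x else 0) hx
    (by rw [map_zero, ite_self]) ?_ ?_
  · intro x y hx hy
    rw [map_add, hx, hy]
    split_ifs
    · rfl
    · exact add_zero 0
  · intro p b hb
    rw [LinearMap.lTensor_tmul, B.proj_of_mem hb]
    split_ifs
    · rfl
    · exact tmul_zero _ _

theorem mul_mem_polyGr {i j : ℕ} {x y : ℚ[X] ⊗[ℚ] B.carrier} (hx : x ∈ B.polyGr i)
    (hy : y ∈ B.polyGr j) : x * y ∈ B.polyGr (i + j) := by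
  refine polyGr_induction (P := fun x => x * y ∈ B.polyGr (i + j)) hx
    (by rw [zero_mul]; exact Submodule.zero_mem _)
    (fun x x' h h' => by rw [add_mul]; exact Submodule.add_mem _ h h') fun p a ha => ?_
  refine polyGr_induction (P := fun y => p ⊗ₜ a * y ∈ B.polyGr (i + j)) hy
    (by rw [mul_zero]; exact Submodule.zero_mem _)
    (fun x x' h h' => by rw [mul_add]; exact Submodule.add_mem _ h h') fun q b hb => ?_
  rw [Algebra.TensorProduct.tmul_mul_tmul]
  exact tmul_mem_polyGr _ (mul_mem_gr ha hb)

theorem polyGr_comm {i j : ℕ} {x y : ℚ[X] ⊗[ℚ] B.carrier} (hx : x ∈ B.polyGr i)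
    (hy : y ∈ B.polyGr j) : x * y = (-1 : ℚ) ^ (i * j) • (y * x) := by
  refine polyGr_induction (P := fun x => x * y = (-1 : ℚ) ^ (i * j) • (y * x)) hx
    (by rw [zero_mul, mul_zero, smul_zero])
    (fun x x' h h' => by rw [add_mul, h, h', mul_add, smul_add]) fun p a ha => ?_
  refine polyGr_induction (P := fun y => p ⊗ₜ a * y = (-1 : ℚ) ^ (i * j) • (y * p ⊗ₜ a)) hy
    (by rw [zero_mul, mul_zero, smul_zero])
    (fun x x' h h' => by rw [mul_add, h, h', add_mul, smul_add]) fun q b hb => ?_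
  rw [Algebra.TensorProduct.tmul_mul_tmul, Algebra.TensorProduct.tmul_mul_tmul,
    B.comm i j a b ha hb, tmul_smul, mul_comm p q]

variable (B) in
/-- The graded algebra `B[t]`, with `t` of degree `0`. -/
def poly : GCAlg.{u} where
  carrier := ℚ[X] ⊗[ℚ] B.carrier
  gr := B.polyGr
  gradedMonoid :=
    { one_mem := tmul_mem_polyGr 1 one_mem_gr
      mul_mem := fun _ _ _ _ => mul_mem_polyGr }
  isInternal := by
    refine isInternal_of_proj _ (fun i => (B.proj i).lTensor ℚ[X]) (fun i x => ⟨x, rfl⟩)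
      (fun i j x hx => proj_of_mem_polyGr hx j) fun x => ?_
    induction x using TensorProduct.induction_on with
    | zero => exact ⟨0, fun k _ => by simp only [map_zero, Finset.sum_const_zero]⟩
    | tmul p b =>
      obtain ⟨N, hN⟩ := B.sum_proj b
      refine ⟨N, fun k hk => ?_⟩
      simp only [LinearMap.lTensor_tmul]
      rw [← tmul_sum, hN k hk]
    | add x y hx hy =>
      obtain ⟨N, hN⟩ := hx
      obtain ⟨N', hN'⟩ := hy
      refine ⟨max N N', fun k hk => ?_⟩
      simp only [map_add, Finset.sum_add_distrib]
      rw [hN k (le_trans (le_max_left _ _) hk), hN' k (le_trans (le_max_right _ _) hk)]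
  comm _ _ _ _ := polyGr_comm

end GCAlg

/-! ### The DGA of polynomials, with evaluation and integration. -/

namespace CDGA

variable (B : CDGA.{u})

theorem lTensor_d_leibniz {i : ℕ} {x : ℚ[X] ⊗[ℚ] B.carrier} (hx : x ∈ B.polyGr i)
    (y : ℚ[X] ⊗[ℚ] B.carrier) : B.d.lTensor ℚ[X] (x * y) =
      B.d.lTensor ℚ[X] x * y + (-1 : ℚ) ^ i • (x * B.d.lTensor ℚ[X] y) := by
  refine GCAlg.polyGr_induction (P := fun x => B.d.lTensor ℚ[X] (x * y) =
    B.d.lTensor ℚ[X] x * y + (-1 : ℚ) ^ i • (x * B.d.lTensor ℚ[X] y)) hx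
    (by simp only [zero_mul, map_zero, smul_zero, add_zero])
    (fun x x' h h' => by simp only [add_mul, map_add, h, h', smul_add]; abel) fun p a ha => ?_
  induction y using TensorProduct.induction_on with
  | zero => simp only [mul_zero, map_zero, smul_zero, add_zero]
  | tmul q b =>
    simp only [LinearMap.lTensor_tmul, Algebra.TensorProduct.tmul_mul_tmul]
    rw [B.leibniz i a b ha, tmul_add, tmul_smul]
  | add y y' h h' =>
    simp only [mul_add, map_add, h, h', smul_add]
    abel

theorem lTensor_d_mem {i : ℕ} {x : ℚ[X] ⊗[ℚ] B.carrier} (hx : x ∈ B.polyGr i) :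
    B.d.lTensor ℚ[X] x ∈ B.polyGr (i + 1) :=
  GCAlg.polyGr_induction (P := fun x => B.d.lTensor ℚ[X] x ∈ B.polyGr (i + 1)) hx
    (by rw [map_zero]; exact Submodule.zero_mem _)
    (fun x x' h h' => by rw [map_add]; exact Submodule.add_mem _ h h')
    fun p a ha => GCAlg.tmul_mem_polyGr p (B.d_mem i a ha)

theorem lTensor_d_d (x : ℚ[X] ⊗[ℚ] B.carrier) : B.d.lTensor ℚ[X] (B.d.lTensor ℚ[X] x) = 0 := by
  induction x using TensorProduct.induction_on with
  | zero => simp only [map_zero]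
  | tmul p b => rw [LinearMap.lTensor_tmul, LinearMap.lTensor_tmul, B.d_d, tmul_zero]
  | add x y hx hy => rw [map_add, map_add, hx, hy, add_zero]

/-- The DGA `B[t]`, with `t` of degree `0` and `dt = 0`. -/
def poly : CDGA.{u} where
  toGCAlg := B.toGCAlg.poly
  d := B.d.lTensor ℚ[X]
  d_mem _ _ := B.lTensor_d_mem
  d_d := B.lTensor_d_d
  leibniz _ _ y hx := B.lTensor_d_leibniz hx y

/-- The elements `p(t) b` of `B[t]`. -/
def polyMk (p : ℚ[X]) : B.carrier →ₗ[ℚ] B.poly.carrier := TensorProduct.mk ℚ ℚ[X] B.carrier p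

variable {B}

theorem polyMk_mul (p q : ℚ[X]) (a b : B.carrier) :
    B.polyMk p a * B.polyMk q b = B.polyMk (p * q) (a * b) :=
  Algebra.TensorProduct.tmul_mul_tmul p q a b

theorem polyMk_add (p q : ℚ[X]) (b : B.carrier) :
    B.polyMk (p + q) b = B.polyMk p b + B.polyMk q b := TensorProduct.add_tmul p q b

theorem polyMk_sub (p q : ℚ[X]) (b : B.carrier) :
    B.polyMk (p - q) b = B.polyMk p b - B.polyMk q b := TensorProduct.sub_tmul p q b

theorem polyMk_C (q : ℚ) (b : B.carrier) : B.polyMk (C q) b = B.polyMk 1 (q • b) := by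
  change (C q ⊗ₜ[ℚ] b : ℚ[X] ⊗[ℚ] B.carrier) = 1 ⊗ₜ[ℚ] (q • b)
  rw [tmul_smul, smul_tmul', smul_eq_C_mul, mul_one]

theorem polyMk_mem (p : ℚ[X]) {i : ℕ} {b : B.carrier} (h : b ∈ B.gr i) :
    B.polyMk p b ∈ B.poly.gr i := GCAlg.tmul_mem_polyGr p h

theorem poly_induction {P : B.poly.carrier → Prop} (x : B.poly.carrier) (h0 : P 0)
    (hadd : ∀ x y, P x → P y → P (x + y)) (h : ∀ p b, P (B.polyMk p b)) : P x :=
  TensorProduct.induction_on (motive := P) x h0 h hadd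

theorem poly_gr_induction {i : ℕ} {P : B.poly.carrier → Prop} {x : B.poly.carrier}
    (hx : x ∈ B.poly.gr i) (h0 : P 0) (hadd : ∀ x y, P x → P y → P (x + y))
    (h : ∀ p, ∀ b ∈ B.gr i, P (B.polyMk p b)) : P x :=
  GCAlg.polyGr_induction (P := P) hx h0 hadd h

/-- Linear maps on `B[t]` agreeing on the `p(t) b` agree. -/
theorem poly_ext {M : Type*} [AddCommGroup M] [Module ℚ M] {f g : B.poly.carrier →ₗ[ℚ] M}
    (h : ∀ (p : ℚ[X]) (b : B.carrier), f (B.polyMk p b) = g (B.polyMk p b))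
    (x : B.poly.carrier) : f x = g x :=
  poly_induction (P := fun x => f x = g x) x (by rw [map_zero, map_zero])
    (fun x y hx hy => by rw [map_add, map_add, hx, hy]) h

variable (B)

/-- A linear operator on polynomials, extended to `B[t]`. -/
def polyMap (f : ℚ[X] →ₗ[ℚ] ℚ[X]) : B.poly.carrier →ₗ[ℚ] B.poly.carrier := f.rTensor B.carrier

variable {B}

theorem polyMap_polyMk (f : ℚ[X] →ₗ[ℚ] ℚ[X]) (p : ℚ[X]) (b : B.carrier) :
    B.polyMap f (B.polyMk p b) = B.polyMk (f p) b := rfl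

theorem d_polyMk (p : ℚ[X]) (b : B.carrier) : B.poly.d (B.polyMk p b) = B.polyMk p (B.d b) := rfl

theorem polyMap_mem (f : ℚ[X] →ₗ[ℚ] ℚ[X]) {i : ℕ} {x : B.poly.carrier} (hx : x ∈ B.poly.gr i) :
    B.polyMap f x ∈ B.poly.gr i :=
  poly_gr_induction (P := fun x => B.polyMap f x ∈ B.poly.gr i) hx
    (by rw [map_zero]; exact Submodule.zero_mem _)
    (fun x x' h h' => by rw [map_add]; exact Submodule.add_mem _ h h')
    fun p a ha => polyMk_mem (f p) ha

theorem polyMap_d (f : ℚ[X] →ₗ[ℚ] ℚ[X]) (x : B.poly.carrier) :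
    B.polyMap f (B.poly.d x) = B.poly.d (B.polyMap f x) :=
  poly_ext (f := B.polyMap f ∘ₗ B.poly.d) (g := B.poly.d ∘ₗ B.polyMap f) (fun _ _ => rfl) x

variable (B) in
/-- Evaluation `B[t] → B` at a rational number, as an algebra map. -/
def polyEvalHom (c : ℚ) : B.poly.carrier →ₐ[ℚ] B.carrier :=
  (Algebra.TensorProduct.lid ℚ B.carrier).toAlgHom.comp
    (Algebra.TensorProduct.map (Polynomial.aeval c) (AlgHom.id ℚ B.carrier))

theorem polyEvalHom_polyMk (c : ℚ) (p : ℚ[X]) (b : B.carrier) :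
    B.polyEvalHom c (B.polyMk p b) = p.eval c • b := by
  change aeval c p • b = _
  rw [Polynomial.coe_aeval_eq_eval]

variable (B) in
/-- Evaluation `B[t] → B` at a rational number. -/
def polyEval (c : ℚ) : B.poly ⟶ B :=
  (⟨⟨B.polyEvalHom c, fun i x hx =>
      poly_gr_induction (P := fun x => B.polyEvalHom c x ∈ B.gr i) hx
        (by rw [map_zero]; exact Submodule.zero_mem _)
        (fun x x' h h' => by rw [map_add]; exact Submodule.add_mem _ h h') fun p a ha => by
          rw [polyEvalHom_polyMk]
          exact Submodule.smul_mem _ _ ha⟩,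
    fun x => poly_ext (f := (B.polyEvalHom c).toLinearMap ∘ₗ B.poly.d)
      (g := B.d ∘ₗ (B.polyEvalHom c).toLinearMap) (fun p b => by
        change B.polyEvalHom c (B.poly.d (B.polyMk p b)) = B.d (B.polyEvalHom c (B.polyMk p b))
        rw [d_polyMk, polyEvalHom_polyMk, polyEvalHom_polyMk, map_smul]) x⟩ :
    CDGA.Hom B.poly B)

theorem polyEval_polyMk (c : ℚ) (p : ℚ[X]) (b : B.carrier) :
    fn (B.polyEval c) (B.polyMk p b) = p.eval c • b := polyEvalHom_polyMk c p b

theorem derivative_antiderivative_poly (x : B.poly.carrier) :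
    B.polyMap derivative (B.polyMap antiderivative x) = x :=
  poly_ext (f := B.polyMap derivative ∘ₗ B.polyMap antiderivative) (g := LinearMap.id)
    (fun p b => by
      rw [LinearMap.comp_apply, polyMap_polyMk, polyMap_polyMk, derivative_antiderivative,
        LinearMap.id_apply]) x

theorem antiderivative_derivative_poly (x : B.poly.carrier) :
    B.polyMap antiderivative (B.polyMap derivative x) = x - B.polyMk 1 (fn (B.polyEval 0) x) :=
  poly_ext (f := B.polyMap antiderivative ∘ₗ B.polyMap derivative)
    (g := LinearMap.id - B.polyMk 1 ∘ₗ (fn (B.polyEval 0)).toLinearMap)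
    (fun p b => by
      change B.polyMap antiderivative (B.polyMap derivative (B.polyMk p b)) =
        B.polyMk p b - B.polyMk 1 (fn (B.polyEval 0) (B.polyMk p b))
      rw [polyMap_polyMk, polyMap_polyMk, antiderivative_derivative, polyEval_polyMk, polyMk_sub,
        polyMk_C]) x

theorem polyEval_zero_antiderivative (x : B.poly.carrier) :
    fn (B.polyEval 0) (B.polyMap antiderivative x) = 0 :=
  poly_ext (f := (fn (B.polyEval 0)).toLinearMap ∘ₗ B.polyMap antiderivative) (g := 0)
    (fun p b => by
      change fn (B.polyEval 0) (B.polyMap antiderivative (B.polyMk p b)) = 0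
      rw [polyMap_polyMk, polyEval_polyMk, eval_zero_antiderivative, zero_smul]) x

theorem polyMap_derivative_mul (x y : B.poly.carrier) :
    B.polyMap derivative (x * y) = B.polyMap derivative x * y + x * B.polyMap derivative y := by
  refine poly_induction (P := fun x : B.poly.carrier =>
    B.polyMap derivative (x * y) = B.polyMap derivative x * y + x * B.polyMap derivative y) x
    (by simp only [zero_mul, map_zero, add_zero])
    (fun a b ha hb => by simp only [add_mul, map_add, ha, hb]; abel) fun p a => ?_
  refine poly_induction (P := fun y : B.poly.carrier =>
    B.polyMap derivative (B.polyMk p a * y) = B.polyMap derivative (B.polyMk p a) * y +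
      B.polyMk p a * B.polyMap derivative y) y
    (by simp only [mul_zero, map_zero, add_zero])
    (fun a b ha hb => by simp only [mul_add, map_add, ha, hb]; abel) fun q b => ?_
  rw [polyMk_mul, polyMap_polyMk, polyMap_polyMk, polyMap_polyMk, polyMk_mul, polyMk_mul,
    derivative_mul, polyMk_add]

/-! ## The path object -/

variable (B) in
/-- The path object `B[t] ⊕ dt B[t]` of a DGA. -/
def path : CDGA.{u} where
  toGCAlg := B.poly.twist 1
  d :=
    -- For `b + dt b'` the differential is `db + dt (∂b/∂t - db')`; the minus sign comes from moving
    -- `d` past `dt`.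
    { toFun := fun x => (B.poly.d x.1, B.polyMap derivative x.1 - B.poly.d x.2)
      map_add' := fun x y => GCAlg.Twist.ext (e := 1) (map_add B.poly.d x.1 y.1) (by
        change B.polyMap derivative (x.1 + y.1) - B.poly.d (x.2 + y.2) =
          (B.polyMap derivative x.1 - B.poly.d x.2) + (B.polyMap derivative y.1 - B.poly.d y.2)
        rw [map_add, map_add]; abel)
      map_smul' := fun q x => GCAlg.Twist.ext (e := 1) (map_smul B.poly.d q x.1) (by
        change B.polyMap derivative (q • x.1) - B.poly.d (q • x.2) =
          q • (B.polyMap derivative x.1 - B.poly.d x.2)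
        rw [map_smul, map_smul, smul_sub]) }
  d_mem i x hx := by
    refine ⟨B.poly.d_mem i _ hx.1, Submodule.sub_mem _ ?_ ?_⟩
    · rw [add_comm, GCAlg.mem_shiftGr_add]
      exact polyMap_mem _ hx.1
    · obtain h | ⟨k, rfl, hk⟩ := (GCAlg.mem_shiftGr 1).1 hx.2
      · rw [h, map_zero]
        exact Submodule.zero_mem _
      · rw [add_assoc, GCAlg.mem_shiftGr_add]
        exact B.poly.d_mem k _ hk
  d_d x := GCAlg.Twist.ext (e := 1) (B.poly.d_d x.1) (by
    change B.polyMap derivative (B.poly.d x.1) -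
      B.poly.d (B.polyMap derivative x.1 - B.poly.d x.2) = 0
    rw [map_sub, B.poly.d_d, polyMap_d, sub_zero, sub_self])
  leibniz i x y hx := by
    have h1 : B.poly.sign 1 x.1 = (-1 : ℚ) ^ i • x.1 := by
      rw [GCAlg.sign_of_mem 1 hx.1, one_mul]
    have h2 : B.poly.sign 1 x.2 = - ((-1 : ℚ) ^ i • x.2) := by
      obtain h | ⟨k, rfl, hk⟩ := (GCAlg.mem_shiftGr 1).1 hx.2
      · rw [h, map_zero, smul_zero, neg_zero]
      · rw [GCAlg.sign_of_mem 1 hk, one_mul, pow_add, pow_one, neg_one_mul, neg_smul, neg_neg]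
    have h3 : (-1 : ℚ) ^ i * (-1 : ℚ) ^ i = 1 := by
      rw [← mul_pow]; norm_num
    refine GCAlg.Twist.ext (e := 1) (B.poly.leibniz i x.1 y.1 hx.1) ?_
    change B.polyMap derivative (x.1 * y.1) -
      B.poly.d (x.2 * y.1 + B.poly.sign 1 x.1 * y.2) =
      ((B.polyMap derivative x.1 - B.poly.d x.2) * y.1 + B.poly.sign 1 (B.poly.d x.1) * y.2) +
      (-1 : ℚ) ^ i • (x.2 * B.poly.d y.1 +
        B.poly.sign 1 x.1 * (B.polyMap derivative y.1 - B.poly.d y.2))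
    rw [polyMap_derivative_mul, map_add, leibniz_sign, leibniz_sign, sign_d, h2, h1, map_smul,
      map_smul, h1, smul_smul, h3, one_smul, mul_sub, smul_add, smul_sub, smul_mul_assoc,
      smul_mul_assoc, smul_mul_assoc, smul_smul, smul_smul, h3, one_smul, one_smul, sub_mul,
      neg_mul, neg_mul, smul_mul_assoc, smul_mul_assoc]
    abel

end CDGA

end PolynomialPaths

/-! ## Fibre products of DGAs -/

namespace CDGA

section Pullback

variable {A P B : CDGA.{u}} (f : A ⟶ B) (g : P ⟶ B)

/-- The underlying subalgebra of the fibre product. -/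
def pullbackSubalgebra : Subalgebra ℚ (A.carrier × P.carrier) :=
  AlgHom.equalizer ((fn f).comp (AlgHom.fst ℚ A.carrier P.carrier))
    ((fn g).comp (AlgHom.snd ℚ A.carrier P.carrier))

variable {f g}

theorem pullbackSubalgebra_ext {x y : pullbackSubalgebra f g} (h1 : x.1.1 = y.1.1)
    (h2 : x.1.2 = y.1.2) : x = y := Subtype.ext (Prod.ext h1 h2)

variable (f g)

/-- The homogeneous parts of the fibre product. -/
def pullbackGr (i : ℕ) : Submodule ℚ (pullbackSubalgebra f g) :=
  (Submodule.prod (A.gr i) (P.gr i)).comap (pullbackSubalgebra f g).val.toLinearMap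

/-- Two linear operators compatible with a linear operator on the target act on the fibre
product. -/
def pullbackMap (a : A.carrier →ₗ[ℚ] A.carrier) (p : P.carrier →ₗ[ℚ] P.carrier)
    (b : B.carrier →ₗ[ℚ] B.carrier) (ha : ∀ x, fn f (a x) = b (fn f x))
    (hp : ∀ x, fn g (p x) = b (fn g x)) : pullbackSubalgebra f g →ₗ[ℚ] pullbackSubalgebra f g :=
  (LinearMap.prodMap a p).restrict (p := Subalgebra.toSubmodule (pullbackSubalgebra f g))
    (q := Subalgebra.toSubmodule (pullbackSubalgebra f g)) fun x hx => by
      have h : fn f x.1 = fn g x.2 := hx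
      change fn f (a x.1) = fn g (p x.2)
      rw [ha, hp, h]

/-- The fibre product of two morphisms of DGAs. -/
def pullback : CDGA.{u} where
  carrier := pullbackSubalgebra f g
  gr := pullbackGr f g
  gradedMonoid :=
    { one_mem := ⟨GCAlg.one_mem_gr, GCAlg.one_mem_gr⟩
      mul_mem := fun _ _ _ _ ha hb => ⟨GCAlg.mul_mem_gr ha.1 hb.1, GCAlg.mul_mem_gr ha.2 hb.2⟩ }
  isInternal := by
    refine isInternal_of_proj _ (fun i => pullbackMap f g (A.proj i) (P.proj i) (B.proj i)
      (GCAlg.fn_proj (CDGA.Hom.toHom f : A.toGCAlg ⟶ B.toGCAlg) i)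
      (GCAlg.fn_proj (CDGA.Hom.toHom g : P.toGCAlg ⟶ B.toGCAlg) i)) ?_ ?_ ?_
    · exact fun i x => ⟨A.proj_mem i _, P.proj_mem i _⟩
    · intro i j x hx
      refine pullbackSubalgebra_ext ((A.proj_of_mem hx.1 j).trans ?_)
        ((P.proj_of_mem hx.2 j).trans ?_) <;> split_ifs <;> rfl
    · intro x
      obtain ⟨N, hN⟩ := A.sum_proj x.1.1
      obtain ⟨N', hN'⟩ := P.sum_proj x.1.2
      refine ⟨max N N', fun k hk => pullbackSubalgebra_ext ?_ ?_⟩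
      · refine (map_sum ((LinearMap.fst ℚ A.carrier P.carrier) ∘ₗ
          (pullbackSubalgebra f g).val.toLinearMap) _ _).trans ?_
        exact hN k (le_trans (le_max_left _ _) hk)
      · refine (map_sum ((LinearMap.snd ℚ A.carrier P.carrier) ∘ₗ
          (pullbackSubalgebra f g).val.toLinearMap) _ _).trans ?_
        exact hN' k (le_trans (le_max_right _ _) hk)
  comm i j a b ha hb := pullbackSubalgebra_ext (A.comm i j _ _ ha.1 hb.1)
    (P.comm i j _ _ ha.2 hb.2)
  d := pullbackMap f g A.d P.d B.d (fn_d f) (fn_d g)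
  d_mem i a ha := ⟨A.d_mem i _ ha.1, P.d_mem i _ ha.2⟩
  d_d a := pullbackSubalgebra_ext (A.d_d _) (P.d_d _)
  leibniz i a b ha := pullbackSubalgebra_ext (A.leibniz i _ _ ha.1) (P.leibniz i _ _ ha.2)

/-- The first projection of the fibre product. -/
def pullbackFst : pullback f g ⟶ A :=
  (⟨⟨(AlgHom.fst ℚ A.carrier P.carrier).comp (pullbackSubalgebra f g).val,
    fun _ _ h => h.1⟩, fun _ => rfl⟩ : CDGA.Hom (pullback f g) A)

/-- The second projection of the fibre product. -/
def pullbackSnd : pullback f g ⟶ P :=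
  (⟨⟨(AlgHom.snd ℚ A.carrier P.carrier).comp (pullbackSubalgebra f g).val,
    fun _ _ h => h.2⟩, fun _ => rfl⟩ : CDGA.Hom (pullback f g) P)

end Pullback

/-! ## Replacing a morphism by a surjective one -/

variable {A B : CDGA.{u}}

variable (B) in
/-- The projection of the path object to polynomials. -/
def pathFst : B.path ⟶ B.poly :=
  (⟨⟨AlgHom.ofLinearMap (LinearMap.fst ℚ B.poly.carrier B.poly.carrier :
    B.poly.Twist 1 →ₗ[ℚ] B.poly.carrier) rfl (fun _ _ => rfl), fun _ _ h => h.1⟩, fun _ => rfl⟩ :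
    CDGA.Hom B.path B.poly)

variable (B) in
/-- The definite integral from `0` to `1` of a path. -/
def pathIntegral : B.path.carrier →ₗ[ℚ] B.carrier :=
  (fn (B.polyEval 1)).toLinearMap ∘ₗ B.polyMap antiderivative ∘ₗ
    (LinearMap.snd ℚ B.poly.carrier B.poly.carrier : B.poly.Twist 1 →ₗ[ℚ] B.poly.carrier)

theorem eval_one_antiderivative_derivative (x : B.poly.carrier) :
    fn (B.polyEval 1) (B.polyMap antiderivative (B.polyMap Polynomial.derivative x)) =
      fn (B.polyEval 1) x - fn (B.polyEval 0) x := by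
  rw [antiderivative_derivative_poly, map_sub, polyEval_polyMk, Polynomial.eval_one, one_smul]

/-- Stokes' formula. -/
theorem d_pathIntegral {x : B.path.carrier} (hx : B.path.d x = 0) :
    B.d (B.pathIntegral x) =
      fn (B.polyEval 1) (fn B.pathFst x) - fn (B.polyEval 0) (fn B.pathFst x) := by
  have h : B.polyMap Polynomial.derivative x.1 - B.poly.d x.2 = 0 :=
    congrArg (Prod.snd : B.poly.carrier × B.poly.carrier → _) hx
  change B.d (fn (B.polyEval 1) (B.polyMap antiderivative x.2)) =
    fn (B.polyEval 1) x.1 - fn (B.polyEval 0) x.1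
  -- Closedness says `db' = ∂b/∂t`, whose integral over `[0, 1]` is `b(1) - b(0)`.
  rw [← fn_d, ← polyMap_d, ← sub_eq_zero.1 h, eval_one_antiderivative_derivative]

variable (f : A ⟶ B)

/-- The mapping path object of a morphism `f : A ⟶ B`, whose elements are the pairs of an element
`a` of `A` and a path in `B` starting at `f a`. -/
def mapPath : CDGA.{u} := pullback f (B.pathFst ≫ B.polyEval 0)

/-- The projection of the mapping path object to the source. -/
def mapPathSrc : mapPath f ⟶ A := pullbackFst f (B.pathFst ≫ B.polyEval 0)

/-- The end point map of the mapping path object. -/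
def mapPathEnd : mapPath f ⟶ B :=
  pullbackSnd f (B.pathFst ≫ B.polyEval 0) ≫ B.pathFst ≫ B.polyEval 1

/-- The path component of a cocycle is a closed path from `f a` to the end point, and its integral
is the required primitive. This is the only form of homotopy needed. -/
theorem mapPath_cohomologous {z : (mapPath f).carrier} (hz : (mapPath f).d z = 0) :
    ∃ c, B.d c = fn (mapPathEnd f) z - fn f (fn (mapPathSrc f) z) := by
  have hz' : B.path.d z.1.2 = 0 :=
    congrArg (fun x : pullbackSubalgebra f (B.pathFst ≫ B.polyEval 0) => x.1.2) hz
  refine ⟨_, (d_pathIntegral hz').trans ?_⟩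
  have h : fn f (fn (mapPathSrc f) z) =
    fn (B.polyEval 0) (fn B.pathFst z.1.2) := z.2
  rw [h]
  rfl

theorem mapPathEnd_surjective (i : ℕ) (b : B.carrier) (hb : b ∈ B.gr i) :
    ∃ z ∈ (mapPath f).gr i, fn (mapPathEnd f) z = b := by
  -- The path `t b` runs from `0 = f 0` to `b`.
  refine ⟨⟨((0 : A.carrier), ((B.polyMk Polynomial.X b, 0) : B.poly.Twist 1)), ?_⟩,
    ⟨Submodule.zero_mem _, polyMk_mem _ hb, Submodule.zero_mem _⟩, ?_⟩
  · change fn f 0 = fn (B.polyEval 0) (B.polyMk Polynomial.X b)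
    rw [map_zero, polyEval_polyMk, Polynomial.eval_X, zero_smul]
  · change fn (B.polyEval 1) (B.polyMk Polynomial.X b) = b
    rw [polyEval_polyMk, Polynomial.eval_X, one_smul]

variable {f}

/-- The kernel `K` of the end point map is the homotopy fibre of `f`. The statement is the part
`H^m(A) → H^m(B) → H^{m+1}(K) → H^{m+1}(A) → H^{m+1}(B)` of its long exact sequence, made explicit.
-/
theorem mapPathEnd_kernel_acyclic {m : ℕ}
    (hsurj : ∀ b ∈ B.gr m, B.d b = 0 → ∃ a ∈ A.gr m, A.d a = 0 ∧ ∃ c, B.d c = b - fn f a)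
    (hinj : ∀ a ∈ A.gr (m + 1), A.d a = 0 → (∃ b, B.d b = fn f a) → ∃ c, A.d c = a)
    (z : (mapPath f).carrier) (hzm : z ∈ (mapPath f).gr (m + 1)) (hpz : fn (mapPathEnd f) z = 0)
    (hdz : (mapPath f).d z = 0) :
    ∃ y ∈ (mapPath f).gr m, fn (mapPathEnd f) y = 0 ∧ (mapPath f).d y = z := by
  -- The degree can be ignored: the degree `m` component of any primitive in the kernel is again
  -- one.
  suffices h : ∃ y, fn (mapPathEnd f) y = 0 ∧ (mapPath f).d y = z by
    obtain ⟨y, hy0, hy⟩ := h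
    refine ⟨(mapPath f).proj m y, (mapPath f).proj_mem m y, ?_, ?_⟩
    · have h := GCAlg.fn_proj (CDGA.Hom.toHom (mapPathEnd f) : (mapPath f).toGCAlg ⟶ B.toGCAlg) m y
      refine h.trans ?_
      rw [show GCAlg.fn (CDGA.Hom.toHom (mapPathEnd f) : (mapPath f).toGCAlg ⟶ B.toGCAlg) y = 0
        from hy0, map_zero]
    · rw [← proj_succ_d, hy, GCAlg.proj_self hzm]
  obtain ⟨⟨a, b, b'⟩, hab⟩ := z
  have hab : fn f a = fn (B.polyEval 0) b := hab
  have ham : a ∈ A.gr (m + 1) := hzm.1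
  have hb'm : b' ∈ B.poly.gr m := by
    have h : b' ∈ B.poly.shiftGr 1 (m + 1) := hzm.2.2
    rwa [add_comm, GCAlg.mem_shiftGr_add] at h
  have hb1 : fn (B.polyEval 1) b = 0 := hpz
  have hda : A.d a = 0 :=
    congrArg (fun x : pullbackSubalgebra f (B.pathFst ≫ B.polyEval 0) => x.1.1) hdz
  have hd2 : B.path.d (b, b') = 0 :=
    congrArg (fun x : pullbackSubalgebra f (B.pathFst ≫ B.polyEval 0) => x.1.2) hdz
  have hdb : B.poly.d b = 0 := congrArg (Prod.fst : B.poly.carrier × B.poly.carrier → _) hd2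
  have hdb' : B.polyMap Polynomial.derivative b = B.poly.d b' :=
    sub_eq_zero.1 (congrArg (Prod.snd : B.poly.carrier × B.poly.carrier → _) hd2)
  -- The integral of `b'` is a primitive of `-f a`, since the path ends at `0`. So `f a` is exact,
  -- and injectivity in degree `m + 1` makes `a` exact.
  have hI : B.d (fn (B.polyEval 1) (B.polyMap antiderivative b')) = - fn f a := by
    rw [← fn_d, ← polyMap_d, ← hdb', eval_one_antiderivative_derivative, hb1, hab, zero_sub]
  obtain ⟨x₀, hx₀⟩ := hinj a ham hda
    ⟨-(fn (B.polyEval 1) (B.polyMap antiderivative b')), by rw [map_neg, hI, neg_neg]⟩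
  have hx₁ : A.d (A.proj m x₀) = a := by rw [← proj_succ_d, hx₀, GCAlg.proj_self ham]
  -- `∫b' + f x₀` is a cocycle of degree `m`. Surjectivity in degree `m` lets `x₀` be changed by a
  -- cocycle `x₂` so that it becomes a coboundary `de`.
  obtain ⟨x₂, -, hx₂, e, he⟩ := hsurj
    (fn (B.polyEval 1) (B.polyMap antiderivative b') + fn f (A.proj m x₀))
    (Submodule.add_mem _ (fn_mem _ (polyMap_mem _ hb'm)) (fn_mem f (A.proj_mem m x₀)))
    (by rw [map_add, hI, ← fn_d, hx₁, neg_add_cancel])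
  have hx : A.d (A.proj m x₀ - x₂) = a := by rw [map_sub, hx₁, hx₂, sub_zero]
  have he' : B.d e = fn (B.polyEval 1) (B.polyMap antiderivative b') +
      fn f (A.proj m x₀ - x₂) := by rw [he, map_sub]; abel
  generalize A.proj m x₀ - x₂ = x at hx he'
  -- The path `f x + ∫₀ᵗ b' - t de` starts at `f x` and ends at `f x + ∫b' - de = 0`. The `dt`-part
  -- `-e` cancels the term `-de` in the `t`-derivative.
  refine ⟨⟨(x, ((B.polyMk 1 (fn f x) + B.polyMap antiderivative b' -
    B.polyMk Polynomial.X (B.d e), - B.polyMk 1 e) : B.poly.Twist 1)), ?_⟩, ?_, ?_⟩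
  · change fn f x = fn (B.polyEval 0) (B.polyMk 1 (fn f x) + B.polyMap antiderivative b' -
      B.polyMk Polynomial.X (B.d e))
    rw [map_sub, map_add, polyEval_polyMk, polyEval_polyMk, polyEval_zero_antiderivative,
      Polynomial.eval_one, Polynomial.eval_X, one_smul, zero_smul, add_zero, sub_zero]
  · change fn (B.polyEval 1) (B.polyMk 1 (fn f x) + B.polyMap antiderivative b' -
      B.polyMk Polynomial.X (B.d e)) = 0
    rw [map_sub, map_add, polyEval_polyMk, polyEval_polyMk, Polynomial.eval_one,
      Polynomial.eval_X, one_smul, one_smul, he']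
    abel
  · refine pullbackSubalgebra_ext hx (GCAlg.Twist.ext (e := 1) ?_ ?_)
    · change B.poly.d (B.polyMk 1 (fn f x) + B.polyMap antiderivative b' -
        B.polyMk Polynomial.X (B.d e)) = b
      rw [map_sub, map_add, d_polyMk, d_polyMk, B.d_d, ← fn_d, hx, ← polyMap_d, ← hdb',
        antiderivative_derivative_poly, map_zero, hab]
      abel
    · change B.polyMap Polynomial.derivative (B.polyMk 1 (fn f x) + B.polyMap antiderivative b' -
        B.polyMk Polynomial.X (B.d e)) - B.poly.d (- B.polyMk 1 e) = b'
      rw [map_sub, map_add, polyMap_polyMk, polyMap_polyMk, derivative_antiderivative_poly,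
        map_neg, d_polyMk, Polynomial.derivative_one, Polynomial.derivative_X,
        show B.polyMk 0 (fn f x) = 0 from TensorProduct.zero_tmul _ _]
      abel

end CDGA

/-! ## Linear algebra -/

/-- Over a field, pointwise solutions on `K` can be chosen linearly: split `S → D(S)`, then extend
from `K` to `W`. -/
theorem exists_linearMap_of_forall_mem {W A A' : Type*} [AddCommGroup W] [Module ℚ W]
    [AddCommGroup A] [Module ℚ A] [AddCommGroup A'] [Module ℚ A'] (K : Submodule ℚ W)
    (S : Submodule ℚ A) (D : A →ₗ[ℚ] A') (u : W →ₗ[ℚ] A')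
    (h : ∀ x ∈ K, ∃ y ∈ S, D y = u x) :
    ∃ κ : W →ₗ[ℚ] A, (∀ x, κ x ∈ S) ∧ ∀ x ∈ K, D (κ x) = u x := by
  obtain ⟨σ, hσ⟩ := (D.domRestrict S).rangeRestrict.exists_rightInverse_of_surjective
    (LinearMap.range_rangeRestrict _)
  let u' : K →ₗ[ℚ] LinearMap.range (D.domRestrict S) :=
    (u.domRestrict K).codRestrict _ fun x => by
      obtain ⟨y, hy, hyx⟩ := h x x.2
      exact ⟨⟨y, hy⟩, hyx⟩
  obtain ⟨κ, hκ⟩ := LinearMap.exists_extend (σ ∘ₗ u')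
  refine ⟨S.subtype ∘ₗ κ, fun x => (κ x).2, fun x hx => ?_⟩
  have h1 : κ x = σ (u' ⟨x, hx⟩) := LinearMap.congr_fun hκ ⟨x, hx⟩
  have h2 := LinearMap.congr_fun hσ (u' ⟨x, hx⟩)
  have h3 : D (σ (u' ⟨x, hx⟩) : S) = u x := congrArg Subtype.val h2
  rw [LinearMap.comp_apply, h1]
  exact h3

theorem exists_lift_extending {X Y A B : Type*} [AddCommGroup X] [Module ℚ X]
    [AddCommGroup Y] [Module ℚ Y] [AddCommGroup A] [Module ℚ A] [AddCommGroup B] [Module ℚ B]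
    (S : Submodule ℚ A) (T : Submodule ℚ B) (q : A →ₗ[ℚ] B) (hST : ∀ a ∈ S, q a ∈ T)
    (hq : ∀ b ∈ T, ∃ a ∈ S, q a = b) (w : X →ₗ[ℚ] Y) (s : X →ₗ[ℚ] A) (hs : ∀ x, s x ∈ S)
    (r : Y →ₗ[ℚ] B) (hr : ∀ y, r y ∈ T) (hsr : ∀ x, q (s x) = r (w x))
    (hker : ∀ x, w x = 0 → s x = 0) :
    ∃ l : Y →ₗ[ℚ] A, (∀ y, l y ∈ S) ∧ (∀ y, q (l y) = r y) ∧ ∀ x, l (w x) = s x := by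
  obtain ⟨κ, -, hκ⟩ := exists_linearMap_of_forall_mem (LinearMap.range w) ⊤ w LinearMap.id
    (fun y ⟨x, hx⟩ => ⟨x, trivial, hx⟩)
  obtain ⟨t, htS, ht⟩ := exists_linearMap_of_forall_mem T S q LinearMap.id hq
  have hκs : ∀ x, s (κ (w x)) = s x := fun x => by
    have h := hker (κ (w x) - x) (by rw [map_sub, hκ _ ⟨x, rfl⟩]; exact sub_self _)
    rwa [map_sub, sub_eq_zero] at h
  -- Here `κ` inverts `w` on its image and `t` is a section of `q`. The first term is forced on the
  -- image of `w`; the second corrects the value under `q` and vanishes on that image.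
  refine ⟨s ∘ₗ κ + t ∘ₗ (r - q ∘ₗ s ∘ₗ κ), fun y => Submodule.add_mem _ (hs _) (htS _),
    fun y => ?_, fun x => ?_⟩
  · have h := ht (r y - q (s (κ y))) (Submodule.sub_mem _ (hr y) (hST _ (hs _)))
    simp only [LinearMap.add_apply, LinearMap.comp_apply, LinearMap.sub_apply, map_add, h,
      LinearMap.id_apply]
    abel
  · simp only [LinearMap.add_apply, LinearMap.comp_apply, LinearMap.sub_apply, hκs, hsr, sub_self,
      map_zero, add_zero]

/-! ## Exactness of resolutions -/

section

variable {G : Type v} [Group G]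

/-- A monomorphism out of the cokernel means exactness at `Y`, which evaluation at an orbit
preserves. -/
theorem exact_at_of_mono {X Y Z : DualCoeff.{v, u} G} (f : X ⟶ Y) (g : Y ⟶ Z) (w : f ≫ g = 0)
    (h : Mono (cokernel.desc f g w)) (H : OrbitCat G) (y : Y.obj H) (hy : (g.app H).hom y = 0) :
    ∃ x, (f.app H).hom x = y := by
  have h1 : (ShortComplex.mk f g w).Exact :=
    (ShortComplex.exact_iff_mono_cokernel_desc _).2 h
  have h2 := h1.map ((evaluation (OrbitCat G) (ModuleCat.{u} ℚ)).obj H)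
  exact (ShortComplex.moduleCat_exact_iff _).1 h2 y hy

theorem injective_app_of_mono {X Y : DualCoeff.{v, u} G} (f : X ⟶ Y) (h : Mono f)
    (H : OrbitCat G) : Function.Injective (f.app H).hom :=
  (ModuleCat.mono_iff_injective _).1 ((NatTrans.mono_iff_mono_app f).1 h H)

namespace MinInjResolution

variable {V : DualCoeff.{v, u} G} (res : MinInjResolution V)

theorem aug_w_apply (H : OrbitCat G) (x : V.obj H) :
    ((res.w 0).app H).hom ((res.aug.app H).hom x) = 0 :=
  congrArg (fun f : V ⟶ res.obj 1 => (f.app H).hom x) res.aug_w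

theorem exact_zero (H : OrbitCat G) (x : (res.obj 0).obj H) (hx : ((res.w 0).app H).hom x = 0) :
    ∃ y, (res.aug.app H).hom y = x :=
  exact_at_of_mono _ _ res.aug_w res.envelope_zero.mono H x hx

theorem exact_succ (i : ℕ) (H : OrbitCat G) (x : (res.obj (i + 1)).obj H)
    (hx : ((res.w (i + 1)).app H).hom x = 0) : ∃ y, ((res.w i).app H).hom y = x :=
  exact_at_of_mono _ _ (res.w_w i) (res.envelope_succ i).mono H x hx

theorem aug_injective (H : OrbitCat G) : Function.Injective (res.aug.app H).hom :=
  injective_app_of_mono _ res.envelope_aug.mono H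

end MinInjResolution

/-! ## Lifting through elementary extensions -/

theorem values_mem {F : DualCoeff.{v, u} G} {U : DGADiagram.{v, u} G} {i : ℕ}
    (η : F ⟶ U ⋙ CDGA.deg i) (H : OrbitCat G) (x : F.obj H) : values η H x ∈ (U.obj H).gr i :=
  Subtype.property ((η.app H).hom x)

namespace ElementaryExtension

variable {m : ℕ} {U E : DGADiagram.{v, u} G} {ι : U ⟶ E} (X : ElementaryExtension m ι)

theorem αs_aug (H : OrbitCat G) (y : X.V.obj H) :
    values (X.αs 0) H ((X.res.aug.app H).hom y) = values X.α H y := by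
  rw [← X.αs_zero]
  rfl

include X in
theorem injective (H : OrbitCat G) : Function.Injective (CDGA.fn (ι.app H)) :=
  (X.free H).injective

theorem exists_hom {H : OrbitCat G} {B : GCAlg.{u}} (φ : (U.obj H).toGCAlg ⟶ B)
    (l : ∀ i, (X.res.obj i).obj H →ₗ[ℚ] B.carrier) (hl : ∀ i x, l i x ∈ B.gr (m + i)) :
    ∃ Φ : (E.obj H).toGCAlg ⟶ B, (∀ u, GCAlg.fn Φ (CDGA.fn (ι.app H) u) = GCAlg.fn φ u) ∧
      ∀ i x, GCAlg.fn Φ (values (X.gen i) H x) = l i x := by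
  obtain ⟨Φ, ⟨hΦ, hΦg⟩, -⟩ := X.free H B φ (fun i => (l i).codRestrict _ (hl i))
  exact ⟨Φ, fun u => congrArg (fun f : (U.obj H).toGCAlg ⟶ B => GCAlg.fn f u) hΦ, hΦg⟩

theorem gcalgHom_ext {H : OrbitCat G} {B : GCAlg.{u}} {Φ Ψ : (E.obj H).toGCAlg ⟶ B}
    (hU : ∀ u, GCAlg.fn Φ (CDGA.fn (ι.app H) u) = GCAlg.fn Ψ (CDGA.fn (ι.app H) u))
    (hg : ∀ i x, GCAlg.fn Φ (values (X.gen i) H x) = GCAlg.fn Ψ (values (X.gen i) H x))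
    (e : (E.obj H).carrier) : GCAlg.fn Φ e = GCAlg.fn Ψ e := by
  obtain ⟨Θ, -, huniq⟩ := X.free H B (CDGA.forgetD.map (ι.app H) ≫ Ψ)
    (fun i => ((GCAlg.fn Ψ).toLinearMap ∘ₗ values (X.gen i) H).codRestrict _
      (fun y => GCAlg.Hom.map_gr Ψ _ _ (values_mem (X.gen i) H y)))
  have h1 : Φ = Θ := huniq Φ ⟨GCAlg.hom_ext hU, hg⟩
  have h2 : Ψ = Θ := huniq Ψ ⟨rfl, fun _ _ => rfl⟩
  rw [h1, h2]

/-- A morphism of graded algebras out of an elementary extension commutes with the differentials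
if it does so on the base and on the generators. -/
theorem map_d_of_gen {H : OrbitCat G} {A : CDGA.{u}}
    (Φ : (E.obj H).toGCAlg ⟶ A.toGCAlg)
    (hU : ∀ u, GCAlg.fn Φ (CDGA.fn (ι.app H) ((U.obj H).d u)) =
      A.d (GCAlg.fn Φ (CDGA.fn (ι.app H) u)))
    (hg : ∀ i x, GCAlg.fn Φ ((E.obj H).d (values (X.gen i) H x)) =
      A.d (GCAlg.fn Φ (values (X.gen i) H x))) (e : (E.obj H).carrier) :
    GCAlg.fn Φ ((E.obj H).d e) = A.d (GCAlg.fn Φ e) := by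
  -- Both `d ∘ Φ` and `Φ ∘ d` are derivations along `Φ` with the same sign rule, so they agree on a
  -- subalgebra.
  let S : Subalgebra ℚ (E.obj H).carrier :=
    { carrier := {e | GCAlg.fn Φ ((E.obj H).d e) = A.d (GCAlg.fn Φ e)}
      mul_mem' := by
        intro a b (ha : _ = _) (hb : _ = _)
        change GCAlg.fn Φ ((E.obj H).d (a * b)) = A.d (GCAlg.fn Φ (a * b))
        rw [CDGA.leibniz_sign, map_mul, CDGA.leibniz_sign, map_add, map_mul, map_mul, ha, hb,
          GCAlg.fn_sign]
      add_mem' := by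
        intro a b (ha : _ = _) (hb : _ = _)
        change GCAlg.fn Φ ((E.obj H).d (a + b)) = A.d (GCAlg.fn Φ (a + b))
        rw [map_add, map_add, map_add, map_add, ha, hb]
      algebraMap_mem' := by
        intro r
        change GCAlg.fn Φ ((E.obj H).d _) = A.d (GCAlg.fn Φ _)
        rw [AlgHom.commutes, Algebra.algebraMap_eq_smul_one, Algebra.algebraMap_eq_smul_one,
          map_smul, CDGA.d_one, smul_zero, map_zero, map_smul, CDGA.d_one, smul_zero] }
  refine (X.free H).mem_of_generated (fun i x => values_mem (X.gen i) H x) S ?_ ?_ hg e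
  · intro i a (ha : _ = _)
    change GCAlg.fn Φ ((E.obj H).d ((E.obj H).proj i (show (E.obj H).carrier from a))) =
      A.d (GCAlg.fn Φ ((E.obj H).proj i (show (E.obj H).carrier from a)))
    rw [← CDGA.proj_succ_d, GCAlg.fn_proj, ha, GCAlg.fn_proj, CDGA.proj_succ_d]
  · intro u
    exact (congrArg (GCAlg.fn Φ) (CDGA.fn_d (ι.app H) u)).symm.trans (hU u)

/-! ### Lifting at a single orbit. -/

section Lift

variable {H : OrbitCat G} {A B : CDGA.{u}} {p : A ⟶ B}
  (hp : ∀ (i : ℕ), ∀ b ∈ B.gr i, ∃ a ∈ A.gr i, CDGA.fn p a = b)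
  (hK : ∀ z ∈ A.gr (m + 1), CDGA.fn p z = 0 → A.d z = 0 →
    ∃ y ∈ A.gr m, CDGA.fn p y = 0 ∧ A.d y = z)
  {φ : U.obj H ⟶ A} {ψ : E.obj H ⟶ B} (hφψ : φ ≫ p = ι.app H ≫ ψ)

include hφψ in
theorem p_φ (u : (U.obj H).carrier) :
    CDGA.fn p (CDGA.fn φ u) = CDGA.fn ψ (CDGA.fn (ι.app H) u) :=
  congrArg (fun f : U.obj H ⟶ B => CDGA.fn f u) hφψ

variable (p φ ψ) in
/-- A linear map on the `i`-th generators of an elementary extension that is a candidate for the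
restriction to them of a lift of `ψ` extending `φ`. -/
structure IsPartialLift (i : ℕ) (l : (X.res.obj i).obj H →ₗ[ℚ] A.carrier) : Prop where
  mem : ∀ x, l x ∈ A.gr (m + i)
  lift : ∀ x, CDGA.fn p (l x) = CDGA.fn ψ (values (X.gen i) H x)
  -- A lift must send `w_i x` to `d(l x) - (-1)^i φ(α_i x)`; this condition says that the
  -- prescription is well defined on the image of `w_i`.
  d_eq : ∀ x, ((X.res.w i).app H).hom x = 0 →
    A.d (l x) = (-1 : ℚ) ^ i • CDGA.fn φ (values (X.αs i) H x)

include hp hK hφψ in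
-- The only place where a cohomological obstruction occurs. For any lift `l` of `ψ`, on `V = ker
-- w_0` the defect `dl - φα` is a cocycle of degree `m + 1` in the kernel of `p`, hence `dκ` with
-- `κ` in that kernel; `l - κ` is then the correct choice.
theorem exists_isPartialLift_zero : ∃ l, X.IsPartialLift p φ ψ 0 l := by
  let r : (X.res.obj 0).obj H →ₗ[ℚ] B.carrier := (CDGA.fn ψ).toLinearMap ∘ₗ values (X.gen 0) H
  have hr : ∀ x, r x ∈ B.gr m := fun x => CDGA.fn_mem ψ (values_mem (X.gen 0) H x)
  let s : (X.res.obj 0).obj H →ₗ[ℚ] A.carrier := (CDGA.fn φ).toLinearMap ∘ₗ values (X.αs 0) H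
  have hs : ∀ x, s x ∈ A.gr (m + 1) := fun x => CDGA.fn_mem φ (values_mem (X.αs 0) H x)
  obtain ⟨l, hlm, hl⟩ := exists_linearMap_of_forall_mem ⊤ (A.gr m) (CDGA.fn p).toLinearMap r
    (fun x _ => hp m _ (hr x))
  have hl' : ∀ x, CDGA.fn p (l x) = r x := fun x => hl x trivial
  obtain ⟨κ, hκm, hκ⟩ := exists_linearMap_of_forall_mem (LinearMap.ker ((X.res.w 0).app H).hom)
    (A.gr m ⊓ LinearMap.ker (CDGA.fn p).toLinearMap) A.d (A.d ∘ₗ l - s) (by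
      intro x hx
      obtain ⟨v, rfl⟩ := X.res.exact_zero H x hx
      obtain ⟨y, hym, hy0, hy⟩ := hK (A.d (l ((X.res.aug.app H).hom v)) -
          s ((X.res.aug.app H).hom v))
        (Submodule.sub_mem _ (A.d_mem m _ (hlm _)) (hs _)) (by
          rw [map_sub, CDGA.fn_d, hl']
          change B.d (CDGA.fn ψ _) - CDGA.fn p (CDGA.fn φ _) = 0
          rw [p_φ hφψ, ← CDGA.fn_d, X.d_gen, X.res.aug_w_apply, map_zero, add_zero, pow_zero,
            one_smul, sub_self]) (by
          rw [map_sub, A.d_d]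
          change 0 - A.d (CDGA.fn φ _) = 0
          rw [← CDGA.fn_d, X.αs_aug, X.α_cocycle, map_zero, sub_zero])
      exact ⟨y, ⟨hym, hy0⟩, hy⟩)
  refine ⟨l - κ, fun x => Submodule.sub_mem _ (hlm x) (hκm x).1, fun x => ?_, fun x hx => ?_⟩
  · have h : CDGA.fn p (κ x) = 0 := (hκm x).2
    rw [LinearMap.sub_apply, map_sub, hl', h, sub_zero]
    rfl
  · rw [LinearMap.sub_apply, map_sub, hκ x hx, LinearMap.sub_apply, pow_zero, one_smul]
    exact sub_sub_cancel _ _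

include hp hφψ in
-- The next map is forced on the image of `w_i` and free elsewhere, subject to lifting `ψ`. Its own
-- compatibility on `ker w_{i+1} = im w_i` follows from `d² = 0` and `dα_i = α_{i+1} w_i`.
theorem exists_isPartialLift_succ {i : ℕ} {l : (X.res.obj i).obj H →ₗ[ℚ] A.carrier}
    (hl : X.IsPartialLift p φ ψ i l) : ∃ l', X.IsPartialLift p φ ψ (i + 1) l' ∧
      ∀ x, l' (((X.res.w i).app H).hom x) =
        A.d (l x) - (-1 : ℚ) ^ i • CDGA.fn φ (values (X.αs i) H x) := by
  obtain ⟨l', hm, hq, hw⟩ := exists_lift_extending (A.gr (m + (i + 1))) (B.gr (m + (i + 1)))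
    (CDGA.fn p).toLinearMap (fun a ha => CDGA.fn_mem p ha) (hp _) ((X.res.w i).app H).hom
    (A.d ∘ₗ l - (-1 : ℚ) ^ i • ((CDGA.fn φ).toLinearMap ∘ₗ values (X.αs i) H))
    (fun x => Submodule.sub_mem _ (A.d_mem _ _ (hl.mem x))
      (Submodule.smul_mem _ _ (CDGA.fn_mem φ (values_mem (X.αs i) H x))))
    ((CDGA.fn ψ).toLinearMap ∘ₗ values (X.gen (i + 1)) H)
    (fun y => CDGA.fn_mem ψ (values_mem (X.gen (i + 1)) H y))
    (fun x => by
      change CDGA.fn p (A.d (l x) - (-1 : ℚ) ^ i • CDGA.fn φ (values (X.αs i) H x)) =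
        CDGA.fn ψ (values (X.gen (i + 1)) H _)
      rw [map_sub, map_smul, p_φ hφψ, CDGA.fn_d, hl.lift, ← CDGA.fn_d, X.d_gen, map_add,
        map_smul, add_sub_cancel_left])
    (fun x hx => by
      change A.d (l x) - (-1 : ℚ) ^ i • CDGA.fn φ (values (X.αs i) H x) = 0
      rw [hl.d_eq x hx, sub_self])
  refine ⟨l', ⟨hm, hq, fun y hy => ?_⟩, hw⟩
  obtain ⟨x, rfl⟩ := X.res.exact_succ i H y hy
  rw [hw]
  change A.d (A.d (l x) - (-1 : ℚ) ^ i • CDGA.fn φ (values (X.αs i) H x)) = _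
  rw [map_sub, A.d_d, map_smul, ← CDGA.fn_d, X.αs_succ, pow_succ, mul_neg_one, neg_smul, zero_sub]

include X hp hK hφψ in
/-- Morphisms out of an elementary extension of degree `m` lift along surjections whose kernel is
acyclic in degree `m + 1`. -/
theorem exists_lift : ∃ Φ : E.obj H ⟶ A, ι.app H ≫ Φ = φ ∧ Φ ≫ p = ψ := by
  obtain ⟨l₀, hl₀⟩ := X.exists_isPartialLift_zero hp hK hφψ
  choose nxt hnxt hw using fun i (l : {l // X.IsPartialLift p φ ψ i l}) =>
    X.exists_isPartialLift_succ hp hφψ l.2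
  let L : ∀ i, {l // X.IsPartialLift p φ ψ i l} :=
    Nat.rec ⟨l₀, hl₀⟩ (fun i l => ⟨nxt i l, hnxt i l⟩)
  have hL : ∀ i x, (L (i + 1)).1 (((X.res.w i).app H).hom x) =
      A.d ((L i).1 x) - (-1 : ℚ) ^ i • CDGA.fn φ (values (X.αs i) H x) := fun i => hw i (L i)
  obtain ⟨Φ, hΦ, hΦg⟩ := X.exists_hom (CDGA.Hom.toHom φ : (U.obj H).toGCAlg ⟶ A.toGCAlg)
    (fun i => (L i).1) (fun i => (L i).2.mem)
  have hΦ' : ∀ u, GCAlg.fn Φ (CDGA.fn (ι.app H) u) = CDGA.fn φ u := hΦ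
  have hd := X.map_d_of_gen Φ (fun u => by rw [hΦ', hΦ', CDGA.fn_d]) (fun i x => by
    rw [X.d_gen, map_add, map_smul, hΦ', hΦg, hΦg, hL]
    abel)
  refine ⟨(⟨Φ, hd⟩ : CDGA.Hom (E.obj H) A), CDGA.hom_ext hΦ', CDGA.hom_ext ?_⟩
  refine X.gcalgHom_ext (Φ := Φ ≫ (CDGA.Hom.toHom p : A.toGCAlg ⟶ B.toGCAlg))
    (Ψ := (CDGA.Hom.toHom ψ : (E.obj H).toGCAlg ⟶ B.toGCAlg)) (fun u => ?_) (fun i x => ?_)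
  · change CDGA.fn p (GCAlg.fn Φ (CDGA.fn (ι.app H) u)) = CDGA.fn ψ (CDGA.fn (ι.app H) u)
    rw [hΦ', p_φ hφψ]
  · change CDGA.fn p (GCAlg.fn Φ (values (X.gen i) H x)) = CDGA.fn ψ (values (X.gen i) H x)
    rw [hΦg, (L i).2.lift]

end Lift

end ElementaryExtension

end

/-! ## Morphisms inducing isomorphisms on cohomology in low degrees -/

namespace CDGA

variable {A B C : CDGA.{u}}

/-- The degree `i` cohomology vanishes. -/
def AcyclicAt (A : CDGA.{u}) (i : ℕ) : Prop := ∀ z ∈ A.gr i, A.d z = 0 → ∃ c, A.d c = z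

/-- The morphism induces an isomorphism on cohomology in degrees `≤ k` and a monomorphism in
degree `k + 1`, in terms of cocycles. -/
structure IsoUpTo (k : ℕ) (f : A ⟶ B) : Prop where
  surj : ∀ i ≤ k, ∀ b ∈ B.gr i, B.d b = 0 → ∃ a ∈ A.gr i, A.d a = 0 ∧ ∃ c, B.d c = b - fn f a
  inj : ∀ i ≤ k + 1, ∀ a ∈ A.gr i, A.d a = 0 → (∃ b, B.d b = fn f a) → ∃ c, A.d c = a

theorem injOn_iff (f : A ⟶ B) (i : ℕ) :
    Set.InjOn (GCAlg.fn (CDGA.H.map f)) ((CDGA.H.obj A).gr i) ↔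
      ∀ a ∈ A.gr i, A.d a = 0 → (∃ b, B.d b = fn f a) → ∃ c, A.d c = a := by
  constructor
  · rintro h a ha hda ⟨b, hb⟩
    have hmem : A.cls ⟨a, hda⟩ ∈ A.cohomologyGr i := ⟨⟨a, hda⟩, ha, rfl⟩
    have h0 : B.cls (cocyclesMap f ⟨a, hda⟩) = 0 := B.cls_eq_zero.2 ⟨b, hb⟩
    exact A.cls_eq_zero.1 (h hmem (Submodule.zero_mem (A.cohomologyGr i))
      (h0.trans (map_zero (GCAlg.fn (CDGA.H.map f))).symm))
  · rintro h _ ⟨a, ha, rfl⟩ _ ⟨a', ha', rfl⟩ (haa : B.cls (cocyclesMap f a) = B.cls (cocyclesMap f a'))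
    rw [← sub_eq_zero, ← map_sub, ← map_sub] at haa
    have h0 : A.cls (a - a') = 0 := A.cls_eq_zero.2
      (h _ (Submodule.sub_mem _ ha ha') (a - a').2 (B.cls_eq_zero.1 haa))
    rw [map_sub, sub_eq_zero] at h0
    exact h0

theorem surjOn_iff (f : A ⟶ B) (i : ℕ) :
    Set.SurjOn (GCAlg.fn (CDGA.H.map f)) ((CDGA.H.obj A).gr i) ((CDGA.H.obj B).gr i) ↔
      ∀ b ∈ B.gr i, B.d b = 0 → ∃ a ∈ A.gr i, A.d a = 0 ∧ ∃ c, B.d c = b - fn f a := by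
  constructor
  · intro h b hb hdb
    obtain ⟨_, ⟨a, ha, rfl⟩, hab⟩ := h ⟨⟨b, hdb⟩, hb, rfl⟩
    have hab : B.cls (cocyclesMap f a) = B.cls ⟨b, hdb⟩ := hab
    rw [eq_comm, ← sub_eq_zero, ← map_sub] at hab
    exact ⟨a, ha, a.2, B.cls_eq_zero.1 hab⟩
  · rintro h _ ⟨b, hb, rfl⟩
    obtain ⟨a, ha, hda, c, hc⟩ := h b hb b.2
    refine ⟨A.cls ⟨a, hda⟩, ⟨⟨a, hda⟩, ha, rfl⟩, ?_⟩
    have h0 : B.cls (b - cocyclesMap f ⟨a, hda⟩) = 0 := B.cls_eq_zero.2 ⟨c, hc⟩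
    rw [map_sub, sub_eq_zero] at h0
    exact h0.symm

namespace IsoUpTo

theorem comp {k : ℕ} {f : A ⟶ B} {g : B ⟶ C} (hf : IsoUpTo k f) (hg : IsoUpTo k g) :
    IsoUpTo k (f ≫ g) where
  surj i hi b hb hdb := by
    obtain ⟨b', hb', hdb', c, hc⟩ := hg.surj i hi b hb hdb
    obtain ⟨a, ha, hda, c', hc'⟩ := hf.surj i hi b' hb' hdb'
    refine ⟨a, ha, hda, c + fn g c', ?_⟩
    rw [map_add, hc, ← fn_d, hc', map_sub, fn_comp]
    abel
  inj i hi a ha hda hb := hf.inj i hi a ha hda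
    (hg.inj i hi _ (fn_mem f ha) (by rw [← fn_d, hda, map_zero]) hb)

/-- If an element of degree at most `k + 1` becomes a coboundary, its primitive can be taken in
degree at most `k`, hence in the source; in degree `0` the only coboundary is `0`. -/
theorem of_injective {k : ℕ} {f : A ⟶ B} (hf : Function.Injective (fn f))
    (hs : ∀ i ≤ k, ∀ b ∈ B.gr i, ∃ a ∈ A.gr i, fn f a = b) : IsoUpTo k f where
  surj i hi b hb hdb := by
    obtain ⟨a, ha, rfl⟩ := hs i hi b hb
    exact ⟨a, ha, hf (by rw [fn_d, hdb, map_zero]), 0, by rw [map_zero, sub_self]⟩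
  inj i hi a ha hda := by
    rintro ⟨b, hb⟩
    have hfa := GCAlg.proj_self (fn_mem f ha)
    rw [← hb] at hfa
    cases i with
    | zero =>
      refine ⟨0, hf ?_⟩
      rw [map_zero, map_zero, ← hb, ← hfa, proj_zero_d]
    | succ j =>
      obtain ⟨c, -, hc⟩ := hs j (by omega) _ (B.proj_mem j b)
      exact ⟨c, hf (by rw [fn_d, hc, ← proj_succ_d, hfa, hb])⟩

theorem of_isIso (k : ℕ) (f : A ⟶ B) [IsIso f] : IsoUpTo k f := by
  have h1 : ∀ a, fn (inv f) (fn f a) = a := fun a =>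
    congrArg (fun g : A ⟶ A => fn g a) (IsIso.hom_inv_id f)
  have h2 : ∀ b, fn f (fn (inv f) b) = b := fun b =>
    congrArg (fun g : B ⟶ B => fn g b) (IsIso.inv_hom_id f)
  exact of_injective (Function.LeftInverse.injective h1)
    fun i _ b hb => ⟨_, fn_mem (inv f) hb, h2 b⟩

theorem acyclicAt {k i : ℕ} {f : A ⟶ B} (hf : IsoUpTo k f) (hi : i ≤ k + 1)
    (hB : B.AcyclicAt i) : A.AcyclicAt i := fun z hz hdz =>
  hf.inj i hi z hz hdz (hB _ (fn_mem f hz) (by rw [← fn_d, hdz, map_zero]))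

theorem succ {k : ℕ} {f : A ⟶ B} (hf : IsoUpTo k f) (hB : B.AcyclicAt (k + 1))
    (hA : A.AcyclicAt (k + 2)) : IsoUpTo (k + 1) f where
  surj i hi b hb hdb := by
    obtain hi | rfl := Nat.le_succ_iff.1 hi
    · exact hf.surj i hi b hb hdb
    · obtain ⟨c, hc⟩ := hB b hb hdb
      exact ⟨0, Submodule.zero_mem _, map_zero _, c, by rw [hc, map_zero, sub_zero]⟩
  inj i hi a ha hda hb := by
    obtain hi | rfl := Nat.le_succ_iff.1 hi
    · exact hf.inj i hi a ha hda hb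
    · exact hA a ha hda

end IsoUpTo

end CDGA

section

variable {G : Type v} [Group G]

theorem isKIso_iff (k : ℕ) {U U' : DGADiagram.{v, u} G} (f : U ⟶ U') :
    IsKIso k f ↔ ∀ H, CDGA.IsoUpTo k (f.app H) := by
  refine forall_congr' fun H => ⟨fun h => ⟨fun i hi => ?_, fun i hi => ?_⟩, fun h =>
    ⟨fun i hi => ⟨?_, ?_, ?_⟩, ?_⟩⟩
  · exact (CDGA.surjOn_iff _ i).1 (h.1 i hi).surjOn
  · obtain hi | rfl := Nat.le_succ_iff.1 hi
    · exact (CDGA.injOn_iff _ i).1 (h.1 i hi).injOn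
    · exact (CDGA.injOn_iff _ _).1 h.2
  · exact fun x hx => GCAlg.Hom.map_gr (CDGA.H.map (f.app H)) i x hx
  · exact (CDGA.injOn_iff _ i).2 (h.inj i (by omega))
  · exact (CDGA.surjOn_iff _ i).2 (h.surj i hi)
  · exact (CDGA.injOn_iff _ _).2 (h.inj _ le_rfl)

/-! ## Stages of minimal systems -/

namespace MinimalSystem

variable (M : MinimalSystem.{v, u} G)

theorem incl_injective (k : ℕ) (H : OrbitCat G) :
    Function.Injective (CDGA.fn ((M.incl k).app H)) := by
  have h := M.toTotal_inclusion k H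
  rw [← M.incl_toTotal k] at h
  exact fun a b hab => h (congrArg (CDGA.fn ((M.toTotal (k + 1)).app H)) hab)

theorem toTotal_incl (k : ℕ) (H : OrbitCat G) (a : ((M.stage k).obj H).carrier) :
    CDGA.fn ((M.toTotal (k + 1)).app H) (CDGA.fn ((M.incl k).app H) a) =
      CDGA.fn ((M.toTotal k).app H) a :=
  congrArg (fun f : M.stage k ⟶ M.total => CDGA.fn (f.app H) a) (M.incl_toTotal k)

theorem nontrivial_stage (k : ℕ) (H : OrbitCat G) : Nontrivial ((M.stage k).obj H).carrier := by
  induction k with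
  | zero => exact (Equiv.ofBijective _ (M.stage_zero H)).symm.nontrivial
  | succ k ih => exact (M.incl_injective k H).nontrivial

/-- Passing from stage `k` to stage `k + 1` adds generators only in degrees `≥ k + 1`, and nothing
when `k = 0`. -/
theorem incl_surjective_of_le (k : ℕ) (H : OrbitCat G) {i : ℕ} (hi : i ≤ k)
    {b : ((M.stage (k + 1)).obj H).carrier} (hb : b ∈ ((M.stage (k + 1)).obj H).gr i) :
    ∃ a ∈ ((M.stage k).obj H).gr i, CDGA.fn ((M.incl k).app H) a = b := by
  cases k with
  | zero =>
    have := M.stage_one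
    have h : CDGA.fn ((M.incl 0).app H) (CDGA.fn (inv ((M.incl 0).app H)) b) = b :=
      congrArg (fun f : (M.stage 1).obj H ⟶ (M.stage 1).obj H => CDGA.fn f b)
        (IsIso.inv_hom_id ((M.incl 0).app H))
    exact ⟨_, CDGA.fn_mem (inv ((M.incl 0).app H)) hb, h⟩
  | succ k =>
    exact ((M.ext k).free H).mem_range_of_lt (fun i x => values_mem ((M.ext k).gen i) H x)
      (by omega) hb

theorem exists_toTotal_eq_of_le {k l : ℕ} (hkl : k ≤ l) (H : OrbitCat G)
    (a : ((M.stage k).obj H).carrier) : ∃ b : ((M.stage l).obj H).carrier,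
      CDGA.fn ((M.toTotal l).app H) b = CDGA.fn ((M.toTotal k).app H) a := by
  induction l, hkl using Nat.le_induction with
  | base => exact ⟨a, rfl⟩
  | succ l _ ih =>
    obtain ⟨b, hb⟩ := ih
    exact ⟨_, (M.toTotal_incl l H b).trans hb⟩

theorem exists_mem_stage {k l : ℕ} (hkl : k ≤ l) (H : OrbitCat G) {i : ℕ} (hi : i ≤ k)
    {b : ((M.stage l).obj H).carrier} (hb : b ∈ ((M.stage l).obj H).gr i) :
    ∃ a ∈ ((M.stage k).obj H).gr i,
      CDGA.fn ((M.toTotal k).app H) a = CDGA.fn ((M.toTotal l).app H) b := by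
  induction l, hkl using Nat.le_induction with
  | base => exact ⟨b, hb, rfl⟩
  | succ l hl ih =>
    obtain ⟨b', hb', rfl⟩ := M.incl_surjective_of_le l H (hi.trans hl) hb
    rw [toTotal_incl]
    exact ih hb'

theorem isoUpTo_toTotal (k : ℕ) (H : OrbitCat G) :
    CDGA.IsoUpTo k ((M.toTotal k).app H) := by
  refine CDGA.IsoUpTo.of_injective (M.toTotal_inclusion k H) fun i hi b hb => ?_
  obtain ⟨l, y, rfl⟩ := M.union H b
  obtain ⟨y', hy'⟩ := M.exists_toTotal_eq_of_le (Nat.le_add_left l k) H y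
  rw [← hy'] at hb ⊢
  exact M.exists_mem_stage (Nat.le_add_right k l) H hi (GCAlg.mem_gr_of_fn_mem
    (f := (CDGA.Hom.toHom ((M.toTotal (k + l)).app H) :
      ((M.stage (k + l)).obj H).toGCAlg ⟶ (M.total.obj H).toGCAlg))
    (M.toTotal_inclusion _ H) hb)

/-- The unique morphism from the constant stage to a DGA. -/
def fromStageZero (H : OrbitCat G) (A : CDGA.{u}) : (M.stage 0).obj H ⟶ A :=
  (⟨⟨(Algebra.ofId ℚ A.carrier).comp
      (AlgEquiv.ofBijective (Algebra.ofId ℚ ((M.stage 0).obj H).carrier)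
        (M.stage_zero H)).symm.toAlgHom, by
      intro i a ha
      obtain ⟨q, rfl⟩ := (M.stage_zero H).2 a
      obtain rfl | hi := eq_or_ne i 0
      · rw [AlgHom.commutes]
        exact GCAlg.algebraMap_mem_gr q
      · rw [GCAlg.eq_zero_of_mem_of_mem ha (GCAlg.algebraMap_mem_gr q) hi, map_zero]
        exact Submodule.zero_mem _⟩, by
      intro a
      obtain ⟨q, rfl⟩ := (M.stage_zero H).2 a
      rw [AlgHom.commutes, Algebra.algebraMap_eq_smul_one, Algebra.algebraMap_eq_smul_one,
        map_smul, CDGA.d_one, smul_zero, map_zero, map_smul, CDGA.d_one, smul_zero]⟩ :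
    CDGA.Hom ((M.stage 0).obj H) A)

theorem stage_zero_hom_ext {H : OrbitCat G} {A : CDGA.{u}} (f g : (M.stage 0).obj H ⟶ A) :
    f = g := by
  refine CDGA.hom_ext fun a => ?_
  obtain ⟨q, rfl⟩ := (M.stage_zero H).2 a
  rw [AlgHom.commutes, AlgHom.commutes]

/-- Induction over the stages: the extension of degree `m` needs acyclicity of the kernel in degree
`m + 1` only, so degrees `m ≤ n` suffice. -/
theorem exists_strict_lift {n : ℕ} {H : OrbitCat G} {A B : CDGA.{u}} {p : A ⟶ B}
    (hp : ∀ (i : ℕ), ∀ b ∈ B.gr i, ∃ a ∈ A.gr i, CDGA.fn p a = b)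
    (hK : ∀ m ≤ n, ∀ z ∈ A.gr (m + 1), CDGA.fn p z = 0 → A.d z = 0 →
      ∃ y ∈ A.gr m, CDGA.fn p y = 0 ∧ A.d y = z)
    (ψ : (M.stage n).obj H ⟶ B) : ∃ Φ : (M.stage n).obj H ⟶ A, Φ ≫ p = ψ := by
  induction n with
  | zero => exact ⟨M.fromStageZero H A, M.stage_zero_hom_ext _ _⟩
  | succ k ih =>
    obtain ⟨φ, hφ⟩ := ih (fun m hm => hK m (by omega)) ((M.incl k).app H ≫ ψ)
    cases k with
    | zero =>
      have := M.stage_one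
      exact ⟨inv ((M.incl 0).app H) ≫ φ, by rw [Category.assoc, hφ, IsIso.inv_hom_id_assoc]⟩
    | succ k =>
      obtain ⟨Φ, -, hΦ⟩ := (M.ext k).exists_lift hp (hK (k + 2) le_rfl) hφ
      exact ⟨Φ, hΦ⟩

/-- Morphisms out of the `n`-th stage lift, up to homotopy, along morphisms that are isomorphisms
on cohomology in degrees `≤ n` and injective in degree `n + 1`. -/
theorem exists_lift {n : ℕ} {H : OrbitCat G} {A B : CDGA.{u}} {g : A ⟶ B}
    (hg : CDGA.IsoUpTo n g) (ψ : (M.stage n).obj H ⟶ B) :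
    ∃ h : (M.stage n).obj H ⟶ A, ∀ z, ((M.stage n).obj H).d z = 0 →
      ∃ c, B.d c = CDGA.fn ψ z - CDGA.fn g (CDGA.fn h z) := by
  -- Lift strictly along the end point map of the mapping path object, then project to `A`.
  obtain ⟨Φ, rfl⟩ := M.exists_strict_lift (CDGA.mapPathEnd_surjective g)
    (fun m hm => CDGA.mapPathEnd_kernel_acyclic (hg.surj m hm) (hg.inj (m + 1) (by omega))) ψ
  refine ⟨Φ ≫ CDGA.mapPathSrc g, fun z hz => ?_⟩
  have h : (CDGA.mapPath g).d (CDGA.fn Φ z) = 0 := by rw [← CDGA.fn_d, hz, map_zero]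
  exact CDGA.mapPath_cohomologous g h

variable {M} in
/-- Between `n`-th stages, isomorphisms in degrees `≤ n` that are injective in degree `n + 1`
detect the vanishing of all cohomology of the target. -/
theorem acyclicAt_target {M' : MinimalSystem.{v, u} G} {n i : ℕ} {H : OrbitCat G}
    {f : (M.stage n).obj H ⟶ (M'.stage n).obj H} (hf : CDGA.IsoUpTo n f)
    (hM : ((M.stage n).obj H).AcyclicAt i) : ((M'.stage n).obj H).AcyclicAt i := by
  -- Lifting the identity gives `g` with `f ∘ g` the identity on cohomology, so `f` is surjective on
  -- cohomology in every degree, not only up to `n`.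
  obtain ⟨g, hg⟩ := M'.exists_lift hf (𝟙 _)
  intro z hz hdz
  obtain ⟨c, hc⟩ := hg z hdz
  obtain ⟨e, he⟩ := hM (CDGA.fn g z) (CDGA.fn_mem g hz) (by rw [← CDGA.fn_d, hdz, map_zero])
  refine ⟨c + CDGA.fn f e, ?_⟩
  rw [map_add, hc, ← CDGA.fn_d, he, CDGA.fn_id, sub_add_cancel]

variable {M} in
/-- Between `n`-th stages, isomorphisms in degrees `≤ n` that are injective in degree `n + 1`
have a partner in the other direction. -/
theorem exists_isoUpTo_symm {M' : MinimalSystem.{v, u} G} {n : ℕ} {H : OrbitCat G}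
    {f : (M.stage n).obj H ⟶ (M'.stage n).obj H} (hf : CDGA.IsoUpTo n f) :
    ∃ g : (M'.stage n).obj H ⟶ (M.stage n).obj H, CDGA.IsoUpTo n g := by
  obtain ⟨g, hg⟩ := M'.exists_lift hf (𝟙 _)
  refine ⟨g, ⟨fun i hi b hb hdb => ?_, fun i hi a ha hda => ?_⟩⟩
  · have hfb : ((M'.stage n).obj H).d (CDGA.fn f b) = 0 := by rw [← CDGA.fn_d, hdb, map_zero]
    refine ⟨CDGA.fn f b, CDGA.fn_mem f hb, hfb, ?_⟩
    obtain ⟨c, hc⟩ := hg _ hfb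
    -- The elements `b` and `g(f b)` have cohomologous images under `f`, which is injective on
    -- cohomology in this degree.
    refine hf.inj i (by omega) _ (Submodule.sub_mem _ hb (CDGA.fn_mem g (CDGA.fn_mem f hb))) ?_
      ⟨c, by rw [hc, map_sub, CDGA.fn_id]⟩
    rw [map_sub, hdb, ← CDGA.fn_d, hfb, map_zero, sub_zero]
  · rintro ⟨b, hb⟩
    obtain ⟨c, hc⟩ := hg a hda
    exact ⟨c + CDGA.fn f b, by rw [map_add, hc, ← CDGA.fn_d, hb, CDGA.fn_id, sub_add_cancel]⟩

end MinimalSystem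

/-! ## Trivial elementary extensions -/

/-- Essentiality applied to the zero endomorphism of `Y`: it is monic on `X = 0`, hence monic. This
is where minimality of the resolution enters. -/
theorem IsInjectiveEnvelope.isZero {X Y : DualCoeff.{v, u} G} {f : X ⟶ Y}
    (h : IsInjectiveEnvelope f) (hX : IsZero X) : IsZero Y := by
  have h1 : Mono (f ≫ (0 : Y ⟶ Y)) := ⟨fun a b _ => hX.eq_of_tgt a b⟩
  have h2 := h.essential Y 0 h1
  exact IsZero.of_mono_zero Y Y

theorem MinInjResolution.isZero_obj {V : DualCoeff.{v, u} G} (res : MinInjResolution V)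
    (hV : IsZero V) (i : ℕ) : IsZero (res.obj i) := by
  induction i with
  | zero => exact res.envelope_aug.isZero hV
  | succ i ih =>
    cases i with
    | zero =>
      exact res.envelope_zero.isZero (IsZero.of_epi (cokernel.π res.aug) ih)
    | succ i =>
      exact (res.envelope_succ i).isZero (IsZero.of_epi (cokernel.π (res.w i)) ih)

namespace ElementaryExtension

variable {m : ℕ} {U E : DGADiagram.{v, u} G} {ι : U ⟶ E} (X : ElementaryExtension (m + 1) ι)

/-- Vanishing of `H^{m+2}(U)` turns each `x ∈ V` into a cocycle `x - u` of `E`, and vanishing of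
`H^{m+1}(E)` makes it exact. The primitive has degree `m`, below all generators, so `x` itself lies
in `U`, contradicting freeness unless `x = 0`. -/
theorem isZero_V (hU : ∀ H, Nontrivial (U.obj H).carrier)
    (hU2 : ∀ H, (U.obj H).AcyclicAt (m + 2)) (hE : ∀ H, (E.obj H).AcyclicAt (m + 1)) :
    IsZero X.V := by
  rw [Functor.isZero_iff]
  intro H
  suffices h : Subsingleton (X.V.obj H) from ModuleCat.isZero_of_subsingleton _
  refine subsingleton_of_forall_eq 0 fun x => ?_
  have hx := values_mem X.α H x
  obtain ⟨u, hu⟩ := hU2 H _ hx (X.α_cocycle H x)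
  have hu' : (U.obj H).d ((U.obj H).proj (m + 1) u) = values X.α H x := by
    rw [← CDGA.proj_succ_d, hu, GCAlg.proj_self hx]
  have hg := values_mem (X.gen 0) H ((X.res.aug.app H).hom x)
  have hv : values (X.gen 0) H ((X.res.aug.app H).hom x) -
      CDGA.fn (ι.app H) ((U.obj H).proj (m + 1) u) ∈ (E.obj H).gr (m + 1) :=
    Submodule.sub_mem _ hg (CDGA.fn_mem (ι.app H) ((U.obj H).proj_mem (m + 1) u))
  obtain ⟨b, hb⟩ := hE H _ hv (by
    rw [map_sub, X.d_gen, X.res.aug_w_apply, map_zero, pow_zero, one_smul, X.αs_aug,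
      ← CDGA.fn_d, hu', add_zero, sub_self])
  obtain ⟨c, hc⟩ : ∃ c : (U.obj H).carrier, CDGA.fn (ι.app H) c = (E.obj H).proj m b := by
    obtain ⟨c, -, hc⟩ := (X.free H).mem_range_of_lt (fun i x => values_mem (X.gen i) H x)
      (Nat.lt_succ_self m) ((E.obj H).proj_mem m b)
    exact ⟨c, hc⟩
  have key : values (X.gen 0) H ((X.res.aug.app H).hom x) =
      CDGA.fn (ι.app H) ((U.obj H).proj (m + 1) u + (U.obj H).d c) := by
    rw [map_add, CDGA.fn_d, hc, ← CDGA.proj_succ_d, hb, GCAlg.proj_self hv]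
    abel
  have : Nontrivial (CDGA.forgetD.obj (U.obj H)).carrier := hU H
  have h0 := (X.free H).eq_zero_of_gen_mem_range (i := 0) key
  exact X.res.aug_injective H (h0.trans (map_zero _).symm)

theorem isIso_of_isZero (hV : IsZero X.V) : IsIso ι := by
  rw [NatTrans.isIso_iff_isIso_app]
  intro H
  refine CDGA.isIso_of_bijective _ ⟨X.injective H, fun e => ?_⟩
  refine (X.free H).mem_of_generated (fun i x => values_mem (X.gen i) H x)
    (CDGA.fn (ι.app H)).range ?_ (fun u => ⟨u, rfl⟩) (fun i x => ?_) e
  · rintro i _ ⟨u, rfl⟩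
    exact ⟨(U.obj H).proj i u,
      GCAlg.fn_proj (CDGA.Hom.toHom (ι.app H) : (U.obj H).toGCAlg ⟶ (E.obj H).toGCAlg) i u⟩
  · have := ModuleCat.subsingleton_of_isZero
      ((Functor.isZero_iff _).1 (X.res.isZero_obj hV i) H)
    have hx : x = 0 := Subsingleton.elim x 0
    exact ⟨0, (map_zero (CDGA.fn (ι.app H))).trans (hx ▸ (map_zero (values (X.gen i) H)).symm)⟩

end ElementaryExtension

/-! ## Cohomology diagrams -/

theorem acyclicAt_of_iso {U : DGADiagram.{v, u} G} {A : GADiagram.{v, u} G}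
    (e : cohomologyDiagram U ≅ A) {i : ℕ} {H : OrbitCat G} (hA : (A.obj H).gr i = ⊥) :
    (U.obj H).AcyclicAt i := by
  intro z hz hdz
  have h1 : GCAlg.fn (e.hom.app H) ((U.obj H).cls ⟨z, hdz⟩) ∈ (A.obj H).gr i :=
    GCAlg.Hom.map_gr (e.hom.app H) i _ ⟨⟨z, hdz⟩, hz, rfl⟩
  rw [hA, Submodule.mem_bot] at h1
  have h2 : ∀ x, GCAlg.fn (e.inv.app H) (GCAlg.fn (e.hom.app H) x) = x := fun x =>
    congrArg (fun f : cohomologyDiagram U ⟶ cohomologyDiagram U => GCAlg.fn (f.app H) x)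
      e.hom_inv_id
  have h3 := h2 ((U.obj H).cls ⟨z, hdz⟩)
  rw [h1, map_zero] at h3
  exact (U.obj H).cls_eq_zero.1 h3.symm

theorem IsQuasiIso.nonempty_iso {U U' : DGADiagram.{v, u} G} {f : U ⟶ U'} (hf : IsQuasiIso f) :
    Nonempty (cohomologyDiagram U ≅ cohomologyDiagram U') := by
  have : IsIso (Functor.whiskerRight f CDGA.H) := by
    rw [NatTrans.isIso_iff_isIso_app]
    exact fun H => GCAlg.isIso_of_bijective _ (hf H)
  let e := asIso (Functor.whiskerRight f CDGA.H)
  exact ⟨e⟩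

/-- The cohomology of a graded algebra with zero differential. -/
def cohomologyZeroD : 𝟭 GCAlg.{u} ⟶ GCAlg.zeroD ⋙ CDGA.H where
  app A := (⟨(GCAlg.zeroD.obj A).cls.comp
      ((AlgHom.id ℚ A.carrier).codRestrict (GCAlg.zeroD.obj A).cocycles fun _ => rfl),
    fun _ a ha => ⟨⟨a, rfl⟩, ha, rfl⟩⟩ : GCAlg.Hom A (CDGA.H.obj (GCAlg.zeroD.obj A)))
  naturality _ _ _ := rfl

theorem cohomologyZeroD_bijective (A : GCAlg.{u}) :
    Function.Bijective (GCAlg.fn (cohomologyZeroD.app A)) := by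
  constructor
  · rw [injective_iff_map_eq_zero]
    intro a ha
    obtain ⟨c, hc⟩ := (GCAlg.zeroD.obj A).cls_eq_zero.1 ha
    exact hc.symm
  · intro x
    obtain ⟨a, rfl⟩ := (GCAlg.zeroD.obj A).cls_surjective x
    exact ⟨a.1, rfl⟩

theorem nonempty_iso_zeroD (A : GADiagram.{v, u} G) :
    Nonempty (A ≅ cohomologyDiagram (A ⋙ GCAlg.zeroD)) := by
  have : IsIso (Functor.whiskerLeft A cohomologyZeroD) := by
    rw [NatTrans.isIso_iff_isIso_app]
    exact fun H => GCAlg.isIso_of_bijective _ (cohomologyZeroD_bijective (A.obj H))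
  let e := asIso (Functor.whiskerLeft A cohomologyZeroD)
  exact ⟨e⟩

theorem IsMinimalModel.nonempty_iso {M : MinimalSystem.{v, u} G} {A : GADiagram.{v, u} G}
    (h : IsMinimalModel M A) : Nonempty (cohomologyDiagram M.total ≅ A) := by
  obtain ⟨U, j, ρ, -, -, hj, hρ⟩ := h
  obtain ⟨e⟩ := hj.nonempty_iso
  obtain ⟨e'⟩ := hρ.nonempty_iso
  obtain ⟨e₀⟩ := nonempty_iso_zeroD A
  exact ⟨e' ≪≫ e.symm ≪≫ e₀.symm⟩

/-! ## Intrinsic formality -/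

namespace MinimalSystem

variable {A : GADiagram.{v, u} G} {n : ℕ}

theorem stage_acyclicAt {M : MinimalSystem.{v, u} G} (e : cohomologyDiagram M.total ≅ A)
    {k i : ℕ} (hi : i ≤ k + 1) {H : OrbitCat G} (hA : (A.obj H).gr i = ⊥) :
    ((M.stage k).obj H).AcyclicAt i :=
  (M.isoUpTo_toTotal k H).acyclicAt hi (acyclicAt_of_iso e hA)

theorem isIso_incl (N : MinimalSystem.{v, u} G)
    (h2 : ∀ H, ((N.stage n).obj H).AcyclicAt (n + 2))
    (h1 : ∀ H, ((N.stage (n + 1)).obj H).AcyclicAt (n + 1)) : IsIso (N.incl n) := by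
  cases n with
  | zero => exact N.stage_one
  | succ n =>
    exact (N.ext n).isIso_of_isZero ((N.ext n).isZero_V (N.nontrivial_stage _) h2 h1)

end MinimalSystem

/-- Formality does not fix the direction of the comparison map. If it points from `N` to `M`, it is
reversed at the given orbit alone, which suffices since acyclicity is a pointwise condition. -/
theorem IsKIntrinsicallyFormal.stage_acyclicAt {A : GADiagram.{v, u} G} {n i : ℕ}
    (hA : IsKIntrinsicallyFormal n A) {M N : MinimalSystem.{v, u} G}
    (hM : Nonempty (cohomologyDiagram M.total ≅ A))
    (hN : Nonempty (cohomologyDiagram N.total ≅ A))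
    (h : ∀ H, ((M.stage n).obj H).AcyclicAt i) (H : OrbitCat G) :
    ((N.stage n).obj H).AcyclicAt i := by
  obtain ⟨f, hf⟩ | ⟨f, hf⟩ := hA M N hM hN
  · exact MinimalSystem.acyclicAt_target ((isKIso_iff n f).1 hf H) (h H)
  · obtain ⟨g, hg⟩ := MinimalSystem.exists_isoUpTo_symm ((isKIso_iff n f).1 hf H)
    exact MinimalSystem.acyclicAt_target hg (h H)

end

end EquivFormal

end

theorem mainTheorem8 {G : Type v} [Group G] [Finite G] (n : ℕ)
    (A : EquivFormal.GADiagram.{v, u} G)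
    (hA : EquivFormal.IsKIntrinsicallyFormal n A)
    (hA1 : ∀ H : EquivFormal.OrbitCat G, (A.obj H).gr (n + 1) = ⊥)
    (hA2 : ∀ H : EquivFormal.OrbitCat G, (A.obj H).gr (n + 2) = ⊥)
    (M : EquivFormal.MinimalSystem.{v, u} G)
    (hM : EquivFormal.IsMinimalModel M A)
    (hstage : IsIso (M.incl n)) :
    EquivFormal.IsKIntrinsicallyFormal (n + 1) A := by
  open EquivFormal in
  -- `H^{n+2}(M_n) = H^{n+2}(M_{n+1})`, and the latter embeds in `A^{n+2} = 0`; for `M_n` alone only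
  -- degrees up to `n + 1` would be controlled.
  have hM2 : ∀ H, ((M.stage n).obj H).AcyclicAt (n + 2) := fun H => by
    obtain ⟨e⟩ := hM.nonempty_iso
    exact (CDGA.IsoUpTo.of_isIso (n + 1) ((M.incl n).app H)).acyclicAt le_rfl
      (MinimalSystem.stage_acyclicAt e le_rfl (hA2 H))
  have key : ∀ N : MinimalSystem.{v, u} G, Nonempty (cohomologyDiagram N.total ≅ A) →
      IsIso (N.incl n) := fun N ⟨e⟩ =>
    N.isIso_incl (hA.stage_acyclicAt hM.nonempty_iso ⟨e⟩ hM2) fun H =>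
      MinimalSystem.stage_acyclicAt e (by omega) (hA1 H)
  have transfer : ∀ N N' : MinimalSystem.{v, u} G, Nonempty (cohomologyDiagram N.total ≅ A) →
      Nonempty (cohomologyDiagram N'.total ≅ A) →
      (∃ f : N.stage n ⟶ N'.stage n, IsKIso n f) →
      ∃ f : N.stage (n + 1) ⟶ N'.stage (n + 1), IsKIso (n + 1) f := by
    rintro N N' ⟨e⟩ ⟨e'⟩ ⟨f, hf⟩
    have := key N ⟨e⟩
    have := key N' ⟨e'⟩
    -- Conjugating by the isomorphisms between stages `n` and `n + 1` gives an `n`-isomorphism of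
    -- `(n+1)`-st stages, which the vanishing of `A^{n+1}` and `A^{n+2}` promotes by one degree.
    refine ⟨inv (N.incl n) ≫ f ≫ N'.incl n, (isKIso_iff _ _).2 fun H => ?_⟩
    refine CDGA.IsoUpTo.succ (((CDGA.IsoUpTo.of_isIso n ((inv (N.incl n)).app H))).comp
      (((isKIso_iff n f).1 hf H).comp (CDGA.IsoUpTo.of_isIso n ((N'.incl n).app H)))) ?_ ?_
    · exact MinimalSystem.stage_acyclicAt e' (by omega) (hA1 H)
    · exact MinimalSystem.stage_acyclicAt e le_rfl (hA2 H)
  intro N N' hN hN'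
  exact (hA N N' hN hN').imp (transfer N N' hN hN') (transfer N' N hN' hN)
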